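/- **Setting.** Let $d\ge 1$, let $E$ be a finite set, and for each $i\in E$ let $F^i:\mathbb R^d\to\mathbb R^d$ be a smooth bounded vector field with flow $(\Phi^i_t)_{t\in\mathbb R}$. Let $M\subset\mathbb R^d$ be compact with $\Phi^i_t(M)\subset M$ for all $i\in E$, $t\ge 0$. For $x\in M$ and $i,j\in E$ let $\lambda(x,i,j)\ge 0$ be jump rates, continuous in $x$, with $\lambda(x,i,i)=0$ and with $(\lambda(x,i,j))_{i,j}$ irreducible for every $x\in M$. Fix $\lambda>0$ with $\sum_j\lambda(x,i,j)<\lambda$ for all $(x,i)\in M\times E$, and put $Q(x,i,j)=\lambda(x,i,j)/\lambda$ for $i\ne j$ and $Q(x,i,i)=1-\sum_{j\neq i}Q(x,i,j)$. Let $U_1,U_2,\dots$ be i.i.d. exponential random variables of parameter $\lambda$ and $T_n=U_1+\cdots+U_n$. Started at $(\tilde X_0,\tilde Y_0)=(x,i)\in M\times E$, let $\tilde X_{n+1}=\Phi^{\tilde Y_n}_{U_{n+1}}(\tilde X_n)$ and, given the past and $U_{n+1}$, let $\tilde Y_{n+1}=j$ with probability $Q(\tilde X_{n+1},\tilde Y_n,j)$.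 Set $Z_t=(\Phi^{\tilde Y_n}_{t-T_n}(\tilde X_n),\tilde Y_n)$ for $T_n\le t<T_{n+1}$, and write $\mathbb P_{x,i}$ for the law started at $(x,i)$. For indices $\mathbf i=(i_0,\dots,i_m)\in E^{m+1}$ and times $\mathbf v=(v_1,\dots,v_m)\in\mathbb R^m$ let $\mathbf\Phi^{\mathbf i}_{\mathbf v}=\Phi^{i_{m-1}}_{v_m}\circ\cdots\circ\Phi^{i_0}_{v_1}$. **Theorem (Absolute continuity, continuous case).** Let $x_0\in M$, let $\mathbf i=(i_0,\dots,i_m)\in E^{m+1}$ and $\mathbf u=(u_1,\dots,u_m)\in[0,\infty)^m$, and put $y=\mathbf\Phi^{\mathbf i}_{\mathbf u}(x_0)$. Suppose that for some $s>u_1+\cdots+u_m$ the map $$\mathbf v\mapsto \Phi^{i_m}_{s-(v_1+\cdots+v_m)}\big(\mathbf\Phi^{\mathbf i}_{\mathbf v}(x_0)\big),\qquad \mathbb R^m\to\mathbb R^d,$$ is a submersion at $\mathbf u$ (its derivative there is surjective). Let $t_0>u_1+\cdots+u_m$ and let $z=\Phi^{i_m}_{t_0-(u_1+\cdots+u_m)}(y)$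 be the endpoint at time $t_0$ of the corresponding trajectory. Then for every neighbourhood $\mathcal W$ of $z$ there are a neighbourhood $\mathcal U_0$ of $x_0$, a nonempty open set $\mathcal V\subset\mathcal W$, which contains $z$ if all $u_k$ are positive, and constants $c,\varepsilon>0$ such that $$\mathbb P_{x,i}\big(Z_t\in A\times\{j\}\big)\ \ge\ c\,\mathrm{Leb}_d(A\cap\mathcal V)$$ for all $x\in\mathcal U_0\cap M$, all $i,j\in E$, all $t\in[t_0,t_0+\varepsilon]$ and all Borel sets $A\subset\mathbb R^d$. -/

import Mathlib

open Set Filter Topology MeasureTheory ProbabilityTheory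
open scoped NNReal ENNReal ContDiff

/-! ### The flow of a smooth bounded vector field on `ℝ^d` -/

theorem lipschitzOnWith_closedBall_of_contDiff {d : ℕ}
    {F : EuclideanSpace ℝ (Fin d) → EuclideanSpace ℝ (Fin d)}
    (hF : ContDiff ℝ ∞ F) (x : EuclideanSpace ℝ (Fin d)) (r : ℝ) :
    ∃ K : ℝ≥0, LipschitzOnWith K F (Metric.closedBall x r) := by
  have hc : Continuous (fderiv ℝ F) := hF.continuous_fderiv (by simp)
  obtain ⟨C, hC⟩ := (isCompact_closedBall x r).exists_bound_of_continuousOn hc.continuousOn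
  refine ⟨C.toNNReal, (convex_closedBall x r).lipschitzOnWith_of_nnnorm_fderiv_le
    (𝕜 := ℝ) (fun y _ => (hF.differentiable (by simp)).differentiableAt) (fun y hy => ?_)⟩
  rw [← NNReal.coe_le_coe]
  exact (hC y hy).trans (Real.le_coe_toNNReal C)

theorem dist_le_of_integralCurve {d : ℕ}
    {F : EuclideanSpace ℝ (Fin d) → EuclideanSpace ℝ (Fin d)} {C : ℝ} (hC : ∀ x, ‖F x‖ ≤ C)
    {γ : ℝ → EuclideanSpace ℝ (Fin d)} {s : Set ℝ} (hs : Convex ℝ s)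
    (hγ : ∀ t ∈ s, HasDerivAt γ (F (γ t)) t) {a b : ℝ} (ha : a ∈ s) (hb : b ∈ s) :
    dist (γ b) (γ a) ≤ C * |b - a| := by
  rw [dist_eq_norm, ← Real.norm_eq_abs]
  exact hs.norm_image_sub_le_of_norm_hasDerivWithin_le
    (fun t ht => (hγ t ht).hasDerivWithinAt) (fun t _ => hC _) ha hb

/-- The Cauchy problem of a smooth bounded vector field has a global solution. -/
theorem exists_global_integralCurve {d : ℕ}
    {F : EuclideanSpace ℝ (Fin d) → EuclideanSpace ℝ (Fin d)}
    (hF : ContDiff ℝ ∞ F) (hb : ∃ C : ℝ, ∀ x, ‖F x‖ ≤ C) (x : EuclideanSpace ℝ (Fin d)) :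
    ∃ γ : ℝ → EuclideanSpace ℝ (Fin d), γ 0 = x ∧ ∀ t, HasDerivAt γ (F (γ t)) t := by
  obtain ⟨C, hC⟩ := hb
  have hC0 : 0 ≤ C := (norm_nonneg _).trans (hC x)
  have key : ∀ a : ℝ, 0 < a → ∃ γ : ℝ → EuclideanSpace ℝ (Fin d), γ 0 = x ∧
      ∀ t ∈ Ioo (-a) a, HasDerivAt γ (F (γ t)) t := by
    intro a ha
    obtain ⟨K, hK⟩ := lipschitzOnWith_closedBall_of_contDiff hF x (C * a)
    have h0 : (0 : ℝ) ∈ Icc (-a) a := ⟨by linarith, ha.le⟩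
    have hP : IsPicardLindelof (fun _ => F) (⟨0, h0⟩ : Icc (-a) a) x
        (⟨C * a, by positivity⟩ : ℝ≥0) 0 ⟨C, hC0⟩ K :=
      IsPicardLindelof.of_time_independent (fun y _ => hC y) hK (by simp; exact le_rfl)
    obtain ⟨α, h1, h2⟩ := hP.exists_eq_forall_mem_Icc_hasDerivWithinAt₀
    exact ⟨α, h1, fun t ht =>
      (h2 t (Ioo_subset_Icc_self ht)).hasDerivAt (Icc_mem_nhds ht.1 ht.2)⟩
  choose! g hg0 hg using key
  have huniq : ∀ a b : ℝ, 0 < a → a ≤ b → EqOn (g a) (g b) (Ioo (-a) a) := by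
    intro a b ha hab
    obtain ⟨K, hK⟩ := lipschitzOnWith_closedBall_of_contDiff hF x (C * a)
    have hsub : Ioo (-a) a ⊆ Ioo (-b) b := Ioo_subset_Ioo (by linarith) hab
    have h0 : (0 : ℝ) ∈ Ioo (-a) a := ⟨by linarith, ha⟩
    have hball : ∀ c : ℝ, 0 < c → Ioo (-a) a ⊆ Ioo (-c) c → ∀ t ∈ Ioo (-a) a,
        g c t ∈ Metric.closedBall x (C * a) := by
      intro c hc hac t ht
      have h := dist_le_of_integralCurve hC (convex_Ioo (-a) a)
        (fun t ht => hg c hc t (hac ht)) h0 ht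
      rw [hg0 c hc, sub_zero] at h
      exact h.trans (mul_le_mul_of_nonneg_left (abs_lt.mpr ht).le hC0)
    exact ODE_solution_unique_of_mem_Ioo (v := fun _ => F)
      (s := fun _ => Metric.closedBall x (C * a)) (fun _ _ => hK) h0
      (fun t ht => ⟨hg a ha t ht, hball a ha subset_rfl t ht⟩)
      (fun t ht => ⟨hg b (ha.trans_le hab) t (hsub ht), hball b (ha.trans_le hab) hsub t ht⟩)
      (by rw [hg0 a ha, hg0 b (ha.trans_le hab)])
  have hpos : ∀ t : ℝ, 0 < |t| + 1 := fun t => by positivity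
  refine ⟨fun t => g (|t| + 1) t, hg0 _ (hpos 0), fun t => ?_⟩
  have ht : t ∈ Ioo (-(|t| + 1)) (|t| + 1) := abs_lt.mp (lt_add_one _)
  have hev : (fun r => g (|r| + 1) r) =ᶠ[𝓝 t] g (|t| + 1) := by
    filter_upwards [Ioo_mem_nhds ht.1 ht.2] with r hr
    have hr' : r ∈ Ioo (-(|r| + 1)) (|r| + 1) := abs_lt.mp (lt_add_one _)
    rcases le_total (|r| + 1) (|t| + 1) with h | h
    · exact huniq _ _ (hpos r) h hr'
    · exact (huniq _ _ (hpos t) h hr).symm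
  exact (hg _ (hpos t) t ht).congr_of_eventuallyEq hev

open Classical in
/-- The flow of the vector field `F`: `flow F t x` is the value at time `t` of the global solution
of `γ' = F γ`, `γ 0 = x`. (For smooth bounded `F` the solution exists and is unique; where there
is no global solution the value is `x`, by convention.) -/
noncomputable def flow {d : ℕ} (F : EuclideanSpace ℝ (Fin d) → EuclideanSpace ℝ (Fin d))
    (t : ℝ) (x : EuclideanSpace ℝ (Fin d)) : EuclideanSpace ℝ (Fin d) :=
  if h : ∃ γ : ℝ → EuclideanSpace ℝ (Fin d), γ 0 = x ∧ ∀ t, HasDerivAt γ (F (γ t)) t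
    then h.choose t else x

theorem flow_spec {d : ℕ} {F : EuclideanSpace ℝ (Fin d) → EuclideanSpace ℝ (Fin d)}
    (hF : ContDiff ℝ ∞ F) (hb : ∃ C : ℝ, ∀ x, ‖F x‖ ≤ C) (x : EuclideanSpace ℝ (Fin d)) :
    flow F 0 x = x ∧ ∀ t, HasDerivAt (fun t => flow F t x) (F (flow F t x)) t := by
  have h := exists_global_integralCurve hF hb x
  have e : (fun t => flow F t x) = h.choose := by
    funext t
    simp only [flow, dif_pos h]
  refine ⟨(congrFun e 0).trans h.choose_spec.1, fun t => ?_⟩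
  have e' : flow F t x = h.choose t := congrFun e t
  rw [e, e']
  exact h.choose_spec.2 t

/-! ### The data -/

/-- The data of the switching process: finitely many smooth bounded vector fields `F i` on `ℝ^d`,
a compact set `M` that is positively invariant under all their flows, jump rates
`rate x i j` on `M`, continuous in `x`, nonnegative, zero on the diagonal and irreducible at every
point, and a constant `lam` that strictly dominates all total jump rates. -/
structure SwitchedSystem (d : ℕ) (E : Type*) [Fintype E] where
  F : E → EuclideanSpace ℝ (Fin d) → EuclideanSpace ℝ (Fin d)
  smooth : ∀ i, ContDiff ℝ ∞ (F i)
  bounded : ∃ C : ℝ, ∀ i x, ‖F i x‖ ≤ C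
  M : Set (EuclideanSpace ℝ (Fin d))
  isCompact_M : IsCompact M
  invariant : ∀ i, ∀ t : ℝ, 0 ≤ t → ∀ x ∈ M, flow (F i) t x ∈ M
  rate : M → E → E → ℝ
  rate_continuous : ∀ i j, Continuous fun x => rate x i j
  rate_nonneg : ∀ x i j, 0 ≤ rate x i j
  rate_self : ∀ x i, rate x i i = 0
  rate_irreducible : ∀ x, (Matrix.of (rate x)).IsIrreducible
  lam : ℝ
  lam_pos : 0 < lam
  sum_rate_lt : ∀ x i, ∑ j, rate x i j < lam

namespace SwitchedSystem

section

variable {d : ℕ} {E : Type*} [Fintype E] (S : SwitchedSystem d E)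

/-- The flow `Φ^i_t`. -/
noncomputable def Phi (i : E) (t : ℝ) (x : EuclideanSpace ℝ (Fin d)) :
    EuclideanSpace ℝ (Fin d) :=
  flow (S.F i) t x

/-- The composite flow `Φ^{i_{m-1}}_{u_m} ∘ ⋯ ∘ Φ^{i_0}_{u_1}` of the index sequence
`(i_0, …, i_m)` and the time sequence `(u_1, …, u_m)`. -/
noncomputable def compositeFlow : {m : ℕ} → (Fin (m + 1) → E) → (Fin m → ℝ) →
    EuclideanSpace ℝ (Fin d) → EuclideanSpace ℝ (Fin d)
  | 0, _, _, x => x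
  | m + 1, i, u, x =>
      S.Phi (i (Fin.last m).castSucc) (u (Fin.last m)) (compositeFlow (Fin.init i) (Fin.init u) x)

/-- The flow for nonnegative times, as a map of `M` to itself. -/
noncomputable def flowM (i : E) (t : ℝ≥0) (x : S.M) : S.M :=
  ⟨S.Phi i t x, S.invariant i t t.2 x x.2⟩

theorem continuous_flowM_time (i : E) (x : S.M) : Continuous fun t => S.flowM i t x := by
  have hb : ∃ C : ℝ, ∀ x, ‖S.F i x‖ ≤ C := S.bounded.imp fun C h => h i
  have h : Continuous fun t => flow (S.F i) t x :=
    continuous_iff_continuousAt.mpr fun t => ((flow_spec (S.smooth i) hb x).2 t).continuousAt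
  exact (h.comp NNReal.continuous_coe).subtype_mk _

theorem continuous_flowM_space (i : E) (t : ℝ≥0) : Continuous (S.flowM i t) := by
  have hb : ∃ C : ℝ, ∀ x, ‖S.F i x‖ ≤ C := S.bounded.imp fun C h => h i
  obtain ⟨r, hr⟩ := S.isCompact_M.isBounded.subset_closedBall 0
  obtain ⟨K, hK⟩ := lipschitzOnWith_closedBall_of_contDiff (S.smooth i) 0 r
  have hd : ∀ (x : S.M) (s : ℝ), HasDerivAt (fun t => flow (S.F i) t x)
      (S.F i (flow (S.F i) s x)) s := fun x s => (flow_spec (S.smooth i) hb x).2 s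
  have hL : LipschitzWith (Real.exp (K * t)).toNNReal (S.flowM i t) := by
    refine LipschitzWith.of_dist_le_mul fun x y => ?_
    have h := dist_le_of_trajectories_ODE_of_mem (v := fun _ => S.F i) (s := fun _ => S.M)
      (f := fun t => flow (S.F i) t x) (g := fun t => flow (S.F i) t y) (a := 0) (b := t)
      (K := K) (δ := dist x y)
      (fun _ _ => hK.mono hr) (fun s _ => (hd x s).continuousAt.continuousWithinAt)
      (fun s _ => (hd x s).hasDerivWithinAt) (fun s hs => S.invariant i s hs.1 x x.2)
      (fun s _ => (hd y s).continuousAt.continuousWithinAt)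
      (fun s _ => (hd y s).hasDerivWithinAt) (fun s hs => S.invariant i s hs.1 y y.2)
      (by rw [(flow_spec (S.smooth i) hb x).1, (flow_spec (S.smooth i) hb y).1]; rfl)
      t ⟨t.2, le_rfl⟩
    rw [sub_zero] at h
    rw [Real.coe_toNNReal _ (Real.exp_pos _).le, mul_comm]
    exact h
  exact hL.continuous

theorem measurable_move [MeasurableSpace E] [MeasurableSingletonClass E] :
    Measurable fun p : (S.M × E) × ℝ≥0 => ((S.flowM p.1.2 p.2 p.1.1, p.1.2) : S.M × E) := by
  have h : ∀ i : E, Measurable fun q : ℝ≥0 × S.M => S.flowM i q.1 q.2 := fun i =>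
    measurable_uncurry_of_continuous_of_measurable (u := fun t x => S.flowM i t x)
      (fun x => S.continuous_flowM_time i x) (fun t => (S.continuous_flowM_space i t).measurable)
  have h' : Measurable fun q : (ℝ≥0 × S.M) × E => S.flowM q.2 q.1.1 q.1.2 :=
    measurable_from_prod_countable_left fun i => h i
  exact (h'.comp ((measurable_snd.prodMk measurable_fst.fst).prodMk measurable_fst.snd)).prodMk
    measurable_fst.snd

/-! ### The embedded chain and the process -/

/-- The jump matrix `Q(x, i, j)`: `rate x i j / lam` off the diagonal, and the remaining mass on
the diagonal. -/
noncomputable def Q [DecidableEq E] (x : S.M) (i j : E) : ℝ :=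
  if i = j then 1 - ∑ k, S.rate x i k / S.lam else S.rate x i j / S.lam

theorem Q_nonneg [DecidableEq E] (x : S.M) (i j : E) : 0 ≤ S.Q x i j := by
  unfold Q
  split_ifs
  · rw [← Finset.sum_div, sub_nonneg, div_le_one S.lam_pos]
    exact (S.sum_rate_lt x i).le
  · exact div_nonneg (S.rate_nonneg x i j) S.lam_pos.le

theorem sum_Q [DecidableEq E] (x : S.M) (i : E) : ∑ j, S.Q x i j = 1 := by
  have h : ∀ j, S.Q x i j =
      (if i = j then 1 - ∑ k, S.rate x i k / S.lam else 0) + S.rate x i j / S.lam := by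
    intro j
    unfold Q
    split_ifs with hij
    · subst hij
      simp [S.rate_self]
    · simp
  simp only [h, Finset.sum_add_distrib, Finset.sum_ite_eq, Finset.mem_univ, if_true]
  ring

theorem continuous_Q [DecidableEq E] (i j : E) : Continuous fun x => S.Q x i j := by
  unfold Q
  split_ifs
  · exact continuous_const.sub
      (continuous_finsetSum _ fun k _ => (S.rate_continuous i k).div_const _)
  · exact (S.rate_continuous i j).div_const _

variable [DecidableEq E] [MeasurableSpace E] [MeasurableSingletonClass E]

/-- The jump kernel on `M × E`: from `(x, i)` to `(x, j)` with probability `Q(x, i, j)`. -/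
noncomputable def jumpKernel : Kernel (S.M × E) (S.M × E) where
  toFun z := ∑ j, ENNReal.ofReal (S.Q z.1 z.2 j) • Measure.dirac (z.1, j)
  measurable' := by
    refine Measure.measurable_of_measurable_coe _ fun A hA => ?_
    simp only [Measure.finsetSum_apply, Measure.smul_apply, smul_eq_mul]
    refine Finset.measurable_fun_sum _ fun j _ => Measurable.mul ?_ ?_
    · refine ENNReal.measurable_ofReal.comp
        (measurable_from_prod_countable_left fun i => (S.continuous_Q i j).measurable)
    · exact (Measure.measurable_coe hA).comp
        (Measure.measurable_dirac.comp (measurable_fst.prodMk measurable_const))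

instance : IsMarkovKernel S.jumpKernel where
  isProbabilityMeasure z := by
    refine ⟨?_⟩
    change (∑ j, ENNReal.ofReal (S.Q z.1 z.2 j) • Measure.dirac (z.1, j)) univ = 1
    simp only [Measure.finsetSum_apply, Measure.smul_apply, smul_eq_mul, measure_univ, mul_one]
    rw [← ENNReal.ofReal_sum_of_nonneg fun j _ => S.Q_nonneg _ _ _, S.sum_Q, ENNReal.ofReal_one]

/-- The exponential law of parameter `lam`, as a law on the nonnegative reals. -/
noncomputable def waitingLaw : Measure ℝ≥0 := (expMeasure S.lam).map Real.toNNReal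

instance : IsProbabilityMeasure S.waitingLaw := by
  have := isProbabilityMeasure_expMeasure S.lam_pos
  exact Measure.isProbabilityMeasure_map measurable_real_toNNReal.aemeasurable

/-- One step of the chain: from `(x, i)`, draw an exponential time `U` of parameter `lam`,
independent of the past, move `x` to `x' = Φ^i_U(x)`, then replace `i` by a random `j` of law
`Q(x', i, ·)`. The step returns `(U, (x', j))`. -/
noncomputable def stepKernel : Kernel (S.M × E) (ℝ≥0 × (S.M × E)) :=
  Kernel.const (S.M × E) S.waitingLaw ⊗ₖ S.jumpKernel.comap _ S.measurable_move

instance : IsMarkovKernel S.stepKernel := by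
  unfold stepKernel
  infer_instance

/-- The step kernel as a kernel on histories (it depends on the current state only). -/
noncomputable def historyKernel (n : ℕ) :
    Kernel (Π _ : Finset.Iic n, ℝ≥0 × (S.M × E)) (ℝ≥0 × (S.M × E)) :=
  S.stepKernel.comap (fun h => (h ⟨n, Finset.mem_Iic.mpr le_rfl⟩).2)
    (measurable_pi_apply _).snd

instance (n : ℕ) : IsMarkovKernel (S.historyKernel n) := by
  unfold historyKernel
  infer_instance

/-- The law `P_{x,i}` of the sequence `(U_n, (X̃_n, Ỹ_n))_{n ≥ 0}` started at `(x, i)`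
(with the convention `U_0 = 0`). -/
noncomputable def pathLaw (x : S.M) (i : E) : Measure (ℕ → ℝ≥0 × (S.M × E)) :=
  Kernel.traj S.historyKernel 0 fun _ => (0, (x, i))

end

section

variable {d : ℕ} {E : Type*} [Fintype E] (S : SwitchedSystem d E)

/-- The `n`-th jump time `T_n = U_1 + ⋯ + U_n`. -/
noncomputable def jumpTime (n : ℕ) (w : ℕ → ℝ≥0 × (S.M × E)) : ℝ≥0 :=
  ∑ k ∈ Finset.range n, (w (k + 1)).1

open Classical in
/-- The process `Z_t = (X_t, Y_t)`: for `T_n ≤ t < T_{n+1}`, `Z_t = (Φ^{Ỹ_n}_{t - T_n}(X̃_n), Ỹ_n)`.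
(When there is no such `n`, an event of probability zero, `Z_t` is the starting point.) -/
noncomputable def Z (t : ℝ≥0) (w : ℕ → ℝ≥0 × (S.M × E)) : S.M × E :=
  if h : ∃ n, S.jumpTime n w ≤ t ∧ t < S.jumpTime (n + 1) w then
    (S.flowM (w h.choose).2.2 (t - S.jumpTime h.choose w) (w h.choose).2.1, (w h.choose).2.2)
  else (w 0).2

end

end SwitchedSystem

/-- `f` is a submersion at `u`: it is differentiable there, with surjective derivative. -/
def SubmersionAt {m d : ℕ} (f : (Fin m → ℝ) → EuclideanSpace ℝ (Fin d)) (u : Fin m → ℝ) : Prop :=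
  DifferentiableAt ℝ f u ∧ Function.Surjective (fderiv ℝ f u)

/-! For a fixed sequence of modes, `Z_t` is a deterministic function of the sojourn times, the map
`endpoint`. The exponential density is bounded below on bounded boxes, and by continuity of `Q`
jumps that are possible along one trajectory keep a probability bounded below along nearby ones.
Hence the law of `Z_t` dominates a multiple of the image of Lebesgue measure on a box of sojourn
times (`le_pathLaw_Z`). Where the endpoint map is a submersion, this image dominates Lebesgue
measure near the endpoint, and strict differentiability makes the bound uniform in the starting
point and in `t`.

The image bound is `measure_mul_measure_inter_ball_le`. Let `R` be a right inverse of the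
derivative. On each slice `a ↦ v + R a` the map is close to the identity, so it covers a ball and at
most doubles volume; Fubini in `(a, v)` and translation invariance do the rest. Only strict
differentiability of the flow is needed, and it follows from the variational equation and Grönwall's
inequality.

Arbitrary initial and final modes, and prescribed switches of rate zero, are handled by inserting
jumps: irreducibility links any two modes by jumps at one point, in zero time (`Reaches.change`).
The enlarged sequence has sojourn times `τ`, some of them zero, with sum exactly `t₀`, so `τ` lies
on the boundary of the admissible region. The argument survives because the directions in the range
of `R` move only positive sojourns and preserve the sum: base points `v` near `τ` with positive
entries and sum below `t₀` form a nonempty open set, and `v + R a` stays admissible.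

Surjectivity of the derivative does not depend on the final time (`surjective_fderiv_endpoint`) and
is an open condition on `u`. Vanishing `u_k` can thus be made slightly positive, at the price of
moving the endpoint away from `z`. -/

/-! ### Estimates on the flow and the variational equation -/

section FlowRegularity

variable {d : ℕ} {F : EuclideanSpace ℝ (Fin d) → EuclideanSpace ℝ (Fin d)}

theorem dist_flow_le (hF : ContDiff ℝ ∞ F) {C : ℝ} (hC : ∀ x, ‖F x‖ ≤ C)
    (s t : ℝ) (x : EuclideanSpace ℝ (Fin d)) :
    dist (flow F t x) (flow F s x) ≤ C * |t - s| :=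
  dist_le_of_integralCurve hC (γ := fun t => flow F t x) convex_univ
    (fun t _ => (flow_spec hF ⟨C, hC⟩ x).2 t) (mem_univ s) (mem_univ t)

/-- The field need not be globally Lipschitz; but, being bounded, it keeps both curves in one ball
over a bounded time interval, and it is Lipschitz on that ball. -/
theorem flow_eq_of_integralCurve (hF : ContDiff ℝ ∞ F) (hb : ∃ C : ℝ, ∀ x, ‖F x‖ ≤ C)
    {x : EuclideanSpace ℝ (Fin d)} {γ : ℝ → EuclideanSpace ℝ (Fin d)} (h0 : γ 0 = x)
    (hγ : ∀ t, HasDerivAt γ (F (γ t)) t) (t : ℝ) : flow F t x = γ t := by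
  obtain ⟨C, hC⟩ := hb
  have hC0 : 0 ≤ C := (norm_nonneg _).trans (hC x)
  obtain ⟨hf0, hf⟩ := flow_spec hF ⟨C, hC⟩ x
  obtain ⟨K, hK⟩ := lipschitzOnWith_closedBall_of_contDiff hF x (C * (|t| + 1))
  have hball : ∀ γ : ℝ → EuclideanSpace ℝ (Fin d), γ 0 = x → (∀ t, HasDerivAt γ (F (γ t)) t) →
      ∀ s ∈ Ioo (-(|t| + 1)) (|t| + 1), γ s ∈ Metric.closedBall x (C * (|t| + 1)) := by
    intro γ h0 hγ s hs
    have h := dist_le_of_integralCurve hC convex_univ (fun t _ => hγ t) (mem_univ 0) (mem_univ s)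
    rw [h0, sub_zero] at h
    exact h.trans (mul_le_mul_of_nonneg_left (abs_lt.mpr hs).le hC0)
  have hpos : 0 < |t| + 1 := by positivity
  exact ODE_solution_unique_of_mem_Ioo (v := fun _ => F)
    (s := fun _ => Metric.closedBall x (C * (|t| + 1))) (fun _ _ => hK)
    (t₀ := 0) ⟨by linarith, hpos⟩
    (fun s hs => ⟨hf s, hball _ hf0 hf s hs⟩) (fun s hs => ⟨hγ s, hball _ h0 hγ s hs⟩)
    (hf0.trans h0.symm) (abs_lt.mp (lt_add_one _))

theorem flow_add (hF : ContDiff ℝ ∞ F) (hb : ∃ C : ℝ, ∀ x, ‖F x‖ ≤ C) (s t : ℝ)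
    (x : EuclideanSpace ℝ (Fin d)) : flow F (s + t) x = flow F s (flow F t x) := by
  refine (flow_eq_of_integralCurve hF hb (γ := fun s => flow F (s + t) x) (by simp)
    (fun s => ?_) s).symm
  exact ((flow_spec hF hb x).2 (s + t)).comp_add_const s t

theorem flow_neg_field (hF : ContDiff ℝ ∞ F) (hb : ∃ C : ℝ, ∀ x, ‖F x‖ ≤ C) (t : ℝ)
    (x : EuclideanSpace ℝ (Fin d)) : flow (-F) t x = flow F (-t) x := by
  have hb' : ∃ C : ℝ, ∀ x, ‖(-F) x‖ ≤ C := by simpa using hb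
  refine flow_eq_of_integralCurve hF.neg hb' (γ := fun s => flow F (-s) x)
    (by simpa using (flow_spec hF hb x).1) (fun s => ?_) t
  have h := ((flow_spec hF hb x).2 (-s)).scomp s (hasDerivAt_neg s)
  simpa [Function.comp_def] using h

theorem flow_mem_closedBall (hF : ContDiff ℝ ∞ F) {C : ℝ} (hC : ∀ x, ‖F x‖ ≤ C) {R t : ℝ}
    {x : EuclideanSpace ℝ (Fin d)} (hx : ‖x‖ ≤ R) (ht : t ∈ Icc (0 : ℝ) 1) :
    flow F t x ∈ Metric.closedBall (0 : EuclideanSpace ℝ (Fin d)) (R + C) := by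
  have h := dist_flow_le hF hC 0 t x
  have hC0 : 0 ≤ C := (norm_nonneg _).trans (hC x)
  rw [(flow_spec hF ⟨C, hC⟩ x).1, sub_zero, abs_of_nonneg ht.1] at h
  rw [mem_closedBall_zero_iff]
  have h1 : ‖flow F t x‖ ≤ ‖x‖ + dist (flow F t x) x := by
    rw [dist_eq_norm]; simpa using norm_add_le x (flow F t x - x)
  nlinarith [ht.2]

/-- The bound `K` on the derivative of the field on a ball makes the flow Lipschitz there. -/
theorem dist_flow_flow_le (hF : ContDiff ℝ ∞ F) {C : ℝ} (hC : ∀ x, ‖F x‖ ≤ C) {R : ℝ} {K : ℝ≥0}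
    (hK : ∀ x ∈ Metric.closedBall (0 : EuclideanSpace ℝ (Fin d)) (R + C), ‖fderiv ℝ F x‖ ≤ K)
    {x y : EuclideanSpace ℝ (Fin d)} (hx : ‖x‖ ≤ R) (hy : ‖y‖ ≤ R) {t : ℝ}
    (ht : t ∈ Icc (0 : ℝ) 1) :
    dist (flow F t x) (flow F t y) ≤ Real.exp K * dist x y := by
  have hd := fun x s => (flow_spec hF ⟨C, hC⟩ x).2 s
  have hL : LipschitzOnWith K F (Metric.closedBall 0 (R + C)) :=
    (convex_closedBall _ _).lipschitzOnWith_of_nnnorm_fderiv_le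
      (𝕜 := ℝ) (fun y _ => (hF.differentiable (by simp)).differentiableAt) fun y hy => by
        rw [← NNReal.coe_le_coe]; exact hK y hy
  have h := dist_le_of_trajectories_ODE_of_mem (v := fun _ => F)
    (s := fun _ => Metric.closedBall 0 (R + C))
    (f := fun t => flow F t x) (g := fun t => flow F t y) (a := 0) (b := 1)
    (K := K) (δ := dist x y)
    (fun _ _ => hL) (fun s _ => (hd x s).continuousAt.continuousWithinAt)
    (fun s _ => (hd x s).hasDerivWithinAt)
    (fun s hs => flow_mem_closedBall hF hC hx (Ico_subset_Icc_self hs))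
    (fun s _ => (hd y s).continuousAt.continuousWithinAt)
    (fun s _ => (hd y s).hasDerivWithinAt)
    (fun s hs => flow_mem_closedBall hF hC hy (Ico_subset_Icc_self hs))
    (by rw [(flow_spec hF ⟨C, hC⟩ x).1, (flow_spec hF ⟨C, hC⟩ y).1]) t ht
  refine h.trans ?_
  rw [mul_comm]
  gcongr
  nlinarith [ht.1, ht.2, K.2]

theorem exists_bound_fderiv (hF : ContDiff ℝ ∞ F) (R : ℝ) :
    ∃ K : ℝ≥0, 1 ≤ K ∧
      ∀ x ∈ Metric.closedBall (0 : EuclideanSpace ℝ (Fin d)) R, ‖fderiv ℝ F x‖ ≤ K := by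
  have hc : Continuous (fderiv ℝ F) := hF.continuous_fderiv (by simp)
  obtain ⟨K, hK⟩ := (isCompact_closedBall (0 : EuclideanSpace ℝ (Fin d)) R).exists_bound_of_continuousOn
    hc.continuousOn
  exact ⟨max 1 K.toNNReal, le_max_left _ _, fun x hx =>
    (hK x hx).trans ((Real.le_coe_toNNReal K).trans (NNReal.coe_le_coe.2 (le_max_right _ _)))⟩

/-- Short-time solutions of the variational equation along the flow. -/
theorem exists_variation (hF : ContDiff ℝ ∞ F) {C : ℝ} (hC : ∀ x, ‖F x‖ ≤ C) {R : ℝ} {K : ℝ≥0}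
    (hK1 : 1 ≤ K)
    (hK : ∀ x ∈ Metric.closedBall (0 : EuclideanSpace ℝ (Fin d)) (R + C), ‖fderiv ℝ F x‖ ≤ K)
    {x : EuclideanSpace ℝ (Fin d)} (hx : ‖x‖ ≤ R) :
    ∃ A : ℝ → EuclideanSpace ℝ (Fin d) →L[ℝ] EuclideanSpace ℝ (Fin d),
      A 0 = ContinuousLinearMap.id ℝ _ ∧ ∀ t ∈ Icc (0 : ℝ) (1 / (2 * K)),
        HasDerivWithinAt A ((fderiv ℝ F (flow F t x)).comp (A t)) (Icc 0 (1 / (2 * K))) t := by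
  have hK1' : (1 : ℝ) ≤ K := by exact_mod_cast hK1
  have hT0 : (0 : ℝ) ≤ 1 / (2 * K) := by positivity
  have hT1 : 1 / (2 * (K : ℝ)) ≤ 1 := by
    rw [div_le_one (by positivity)]; linarith
  have hmem : ∀ t ∈ Icc (0 : ℝ) (1 / (2 * K)), ‖fderiv ℝ F (flow F t x)‖ ≤ K := fun t ht =>
    hK _ (flow_mem_closedBall hF hC hx ⟨ht.1, ht.2.trans hT1⟩)
  have hc : Continuous (fderiv ℝ F) := hF.continuous_fderiv (by simp)
  have hcf : Continuous fun t => flow F t x :=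
    continuous_iff_continuousAt.mpr fun t => ((flow_spec hF ⟨C, hC⟩ x).2 t).continuousAt
  -- Within distance 1 of the identity `‖A‖ ≤ 2`, so the speed is at most `2 * K` and the solution
  -- stays in that ball up to time `1 / (2 * K)`.
  have hP : IsPicardLindelof
      (fun t (A : EuclideanSpace ℝ (Fin d) →L[ℝ] EuclideanSpace ℝ (Fin d)) =>
        (fderiv ℝ F (flow F t x)).comp A)
      (⟨0, left_mem_Icc.2 hT0⟩ : Icc (0 : ℝ) (1 / (2 * K)))
      (ContinuousLinearMap.id ℝ _) 1 0 (2 * K) K := by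
    refine ⟨fun t ht => ?_, fun A _ => ?_, fun t ht A hA => ?_, ?_⟩
    · refine LipschitzWith.lipschitzOnWith (LipschitzWith.of_dist_le_mul fun A B => ?_)
      rw [dist_eq_norm, dist_eq_norm, ← ContinuousLinearMap.comp_sub]
      exact (ContinuousLinearMap.opNorm_comp_le _ _).trans
        (mul_le_mul_of_nonneg_right (hmem t ht) (norm_nonneg _))
    · exact ((hc.comp hcf).clm_comp continuous_const).continuousOn
    · refine (ContinuousLinearMap.opNorm_comp_le _ _).trans ?_
      have hA' : ‖A‖ ≤ 2 := by
        have h1 : ‖A - ContinuousLinearMap.id ℝ _‖ ≤ 1 := by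
          simpa [dist_eq_norm] using hA
        have h2 := norm_add_le (A - ContinuousLinearMap.id ℝ _) (ContinuousLinearMap.id ℝ _)
        rw [sub_add_cancel] at h2
        have h3 : ‖ContinuousLinearMap.id ℝ (EuclideanSpace ℝ (Fin d))‖ ≤ 1 :=
          ContinuousLinearMap.norm_id_le
        linarith
      have := mul_le_mul (hmem t ht) hA' (norm_nonneg _) K.2
      push_cast
      linarith
    · simp only [sub_zero, sub_self, max_eq_left hT0]
      push_cast
      rw [mul_one_div_cancel (by positivity)]
      simp
  obtain ⟨A, hA0, hA⟩ := hP.exists_eq_forall_mem_Icc_hasDerivWithinAt₀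
  exact ⟨A, hA0, hA⟩

end FlowRegularity

/-! ### Joint strict differentiability of the flow -/

section FlowStrictDeriv

variable {d : ℕ} {F : EuclideanSpace ℝ (Fin d) → EuclideanSpace ℝ (Fin d)}

/-- A solution of the variational equation is the strict derivative of the flow in space,
uniformly on the time interval. -/
theorem eventually_norm_flow_sub_variation_le (hF : ContDiff ℝ ∞ F) {C : ℝ} (hC : ∀ x, ‖F x‖ ≤ C)
    {R : ℝ} {K : ℝ≥0} (hK1 : 1 ≤ K)
    (hK : ∀ x ∈ Metric.closedBall (0 : EuclideanSpace ℝ (Fin d)) (R + C), ‖fderiv ℝ F x‖ ≤ K)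
    {x : EuclideanSpace ℝ (Fin d)} (hx : ‖x‖ < R) {T : ℝ} (hT : T ≤ 1)
    {A : ℝ → EuclideanSpace ℝ (Fin d) →L[ℝ] EuclideanSpace ℝ (Fin d)}
    (hA0 : A 0 = ContinuousLinearMap.id ℝ _)
    (hA : ∀ t ∈ Icc (0 : ℝ) T,
      HasDerivWithinAt A ((fderiv ℝ F (flow F t x)).comp (A t)) (Icc 0 T) t)
    {ε : ℝ} (hε : 0 < ε) :
    ∃ δ > 0, ∀ y ∈ Metric.ball x δ, ∀ y' ∈ Metric.ball x δ, ∀ t ∈ Icc (0 : ℝ) T,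
      ‖flow F t y - flow F t y' - A t (y - y')‖ ≤ ε * ‖y - y'‖ := by
  have hK1' : (1 : ℝ) ≤ K := by exact_mod_cast hK1
  have hd := fun x s => (flow_spec hF ⟨C, hC⟩ x).2 s
  have h0 := fun x => (flow_spec hF ⟨C, hC⟩ x).1
  set e := Real.exp K with he
  have he0 : 0 < e := Real.exp_pos _
  have hη : 0 < ε / (e * e) := by positivity
  have hc : Continuous (fderiv ℝ F) := hF.continuous_fderiv (by simp)
  have huc := (isCompact_closedBall (0 : EuclideanSpace ℝ (Fin d))
    (R + C)).uniformContinuousOn_of_continuous hc.continuousOn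
  obtain ⟨r, hr, hrr⟩ := Metric.uniformContinuousOn_iff.1 huc (ε / (e * e)) hη
  refine ⟨min (r / e) (R - ‖x‖), lt_min (by positivity) (by linarith), fun y hy y' hy' => ?_⟩
  have hnorm : ∀ z ∈ Metric.ball x (min (r / e) (R - ‖x‖)), ‖z‖ ≤ R ∧ e * dist z x < r := by
    intro z hz
    rw [Metric.mem_ball, lt_min_iff] at hz
    refine ⟨?_, by rw [mul_comm]; exact (lt_div_iff₀ he0).1 hz.1⟩
    have := norm_add_le (z - x) x
    rw [sub_add_cancel, ← dist_eq_norm] at this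
    linarith [hz.2]
  obtain ⟨hyR, hyr⟩ := hnorm y hy
  obtain ⟨hyR', hyr'⟩ := hnorm y' hy'
  have hI : ∀ t ∈ Ico (0 : ℝ) T, t ∈ Icc (0 : ℝ) 1 := fun t ht => ⟨ht.1, ht.2.le.trans hT⟩
  have hcx : ∀ z, ContinuousOn (fun t => flow F t z) (Icc 0 T) := fun z s _ =>
    (hd z s).continuousAt.continuousWithinAt
  -- The difference of two trajectories solves the variational equation up to the error of
  -- linearising `F` at `flow F t x`. That error is at most `ε / (e * e)` times the distance of the
  -- trajectories, itself at most `e * ‖y - y'‖`. Grönwall costs one more factor `e`, the division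
  -- by `K` being harmless as `1 ≤ K`.
  have key := dist_le_of_approx_trajectories_ODE_of_mem
    (v := fun t z => fderiv ℝ F (flow F t x) z) (s := fun _ => univ) (K := K)
    (f := fun t => flow F t y - flow F t y') (f' := fun t => F (flow F t y) - F (flow F t y'))
    (g := fun t => A t (y - y')) (g' := fun t => fderiv ℝ F (flow F t x) (A t (y - y')))
    (a := 0) (b := T) (εf := ε / (e * e) * (e * ‖y - y'‖)) (εg := 0) (δ := 0)
    (fun t ht => ((fderiv ℝ F (flow F t x)).lipschitz.weaken
      (by rw [← NNReal.coe_le_coe]; exact hK _ (flow_mem_closedBall hF hC hx.le (hI t ht)))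
      ).lipschitzOnWith)
    ((hcx y).sub (hcx y'))
    (fun t _ => ((hd y t).sub (hd y' t)).hasDerivWithinAt)
    (fun t ht => ?_) (fun _ _ => mem_univ _)
    (fun t ht => ((hA t ht).continuousWithinAt.clm_apply continuousWithinAt_const))
    (fun t ht => ?_) (fun t _ => by simp) (fun _ _ => mem_univ _) (by simp [h0, hA0])
  · intro t ht
    have h := key t ht
    rw [dist_eq_norm, gronwallBound_of_K_ne_0 (by positivity)] at h
    refine h.trans ?_
    simp only [sub_zero, zero_mul, zero_add, add_zero]
    have h1 : Real.exp (K * t) ≤ e := by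
      rw [he]; gcongr
      nlinarith [ht.1, ht.2, K.2]
    calc ε / (e * e) * (e * ‖y - y'‖) / K * (Real.exp (K * t) - 1)
        ≤ ε / (e * e) * (e * ‖y - y'‖) / 1 * e := by
          gcongr
          · have : (1:ℝ) ≤ Real.exp (K * t) := Real.one_le_exp (mul_nonneg K.2 ht.1)
            linarith
          · linarith
      _ = ε * ‖y - y'‖ := by field_simp
  · have hxm := flow_mem_closedBall hF hC hx.le (hI t ht)
    have hs : Convex ℝ (Metric.ball (flow F t x) r ∩ Metric.closedBall 0 (R + C)) :=
      (convex_ball _ _).inter (convex_closedBall _ _)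
    have hmem : ∀ z, ‖z‖ ≤ R → e * dist z x < r →
        flow F t z ∈ Metric.ball (flow F t x) r ∩ Metric.closedBall 0 (R + C) := fun z hz hzr =>
      ⟨(dist_flow_flow_le hF hC hK hz hx.le (hI t ht)).trans_lt hzr,
        flow_mem_closedBall hF hC hz (hI t ht)⟩
    have h := hs.norm_image_sub_le_of_norm_hasFDerivWithin_le' (f := F) (f' := fderiv ℝ F)
      (φ := fderiv ℝ F (flow F t x)) (C := ε / (e * e)) (𝕜 := ℝ)
      (fun z _ => ((hF.differentiable (by simp)) z).hasFDerivAt.hasFDerivWithinAt)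
      (fun z hz => by
        rw [← dist_eq_norm]; exact (hrr z hz.2 _ hxm hz.1).le)
      (hmem y' hyR' hyr') (hmem y hyR hyr)
    rw [dist_eq_norm]
    refine h.trans ?_
    gcongr
    rw [← dist_eq_norm, ← dist_eq_norm]
    exact dist_flow_flow_le hF hC hK hyR hyR' (hI t ht)
  · have h1 := (hA t (Ico_subset_Icc_self ht)).clm_apply (hasDerivWithinAt_const t _ (y - y'))
    simp only [map_zero, add_zero] at h1
    exact (h1.mono_of_mem_nhdsWithin (Icc_mem_nhdsGE_of_mem ht))

theorem continuous_flow_uncurry_at (hF : ContDiff ℝ ∞ F) {C : ℝ} (hC : ∀ x, ‖F x‖ ≤ C) {R : ℝ}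
    {K : ℝ≥0}
    (hK : ∀ x ∈ Metric.closedBall (0 : EuclideanSpace ℝ (Fin d)) (R + C), ‖fderiv ℝ F x‖ ≤ K)
    {x : EuclideanSpace ℝ (Fin d)} (hx : ‖x‖ < R) {t : ℝ} (ht : t ∈ Icc (0 : ℝ) 1) :
    ContinuousAt (fun p : ℝ × EuclideanSpace ℝ (Fin d) => flow F p.1 p.2) (t, x) := by
  have hev : ∀ᶠ p : ℝ × EuclideanSpace ℝ (Fin d) in 𝓝 (t, x), dist (flow F p.1 p.2) (flow F t x) ≤
      C * |p.1 - t| + Real.exp K * dist p.2 x := by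
    have : ∀ᶠ p : ℝ × EuclideanSpace ℝ (Fin d) in 𝓝 (t, x), ‖p.2‖ < R :=
      (continuous_snd.norm.tendsto (t, x)).eventually_lt_const hx
    filter_upwards [this] with p hp
    exact (dist_triangle _ (flow F t p.2) _).trans (add_le_add (dist_flow_le hF hC _ _ _)
      (dist_flow_flow_le hF hC hK hp.le hx.le ht))
  refine tendsto_iff_dist_tendsto_zero.2 (squeeze_zero' (.of_forall fun _ => dist_nonneg) hev ?_)
  have hcont : Continuous fun p : ℝ × EuclideanSpace ℝ (Fin d) =>
      C * |p.1 - t| + Real.exp K * dist p.2 x := by fun_prop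
  simpa using hcont.tendsto (t, x)

/-- The increment splits into a time increment from a fixed point (mean value inequality), a space
increment at a fixed time (variational equation), and the change of `A` in time. Interior times are
needed because `A` solves its equation only on `[0, 1 / (2 * K)]`. -/
theorem hasStrictFDerivAt_flow_short (hF : ContDiff ℝ ∞ F) {C : ℝ} (hC : ∀ x, ‖F x‖ ≤ C)
    {R : ℝ} {K : ℝ≥0} (hK1 : 1 ≤ K)
    (hK : ∀ x ∈ Metric.closedBall (0 : EuclideanSpace ℝ (Fin d)) (R + C), ‖fderiv ℝ F x‖ ≤ K)
    {x : EuclideanSpace ℝ (Fin d)} (hx : ‖x‖ < R) {t : ℝ} (ht : t ∈ Ioo (0 : ℝ) (1 / (2 * K))) :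
    ∃ L : ℝ × EuclideanSpace ℝ (Fin d) →L[ℝ] EuclideanSpace ℝ (Fin d), HasStrictFDerivAt
      (fun p : ℝ × EuclideanSpace ℝ (Fin d) => flow F p.1 p.2) L (t, x) := by
  have hK1' : (1 : ℝ) ≤ K := by exact_mod_cast hK1
  have hT1 : 1 / (2 * (K : ℝ)) ≤ 1 := by
    rw [div_le_one (by positivity)]; linarith
  obtain ⟨A, hA0, hA⟩ := exists_variation hF hC hK1 hK hx.le
  set T : ℝ := 1 / (2 * K)
  have hAc : ContinuousAt A t :=
    ((hA t (Ioo_subset_Icc_self ht)).hasDerivAt (Icc_mem_nhds ht.1 ht.2)).continuousAt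
  have hΦc := continuous_flow_uncurry_at hF hC hK hx ⟨ht.1.le, ht.2.le.trans hT1⟩
  have hFc : ContinuousAt (fun p : ℝ × EuclideanSpace ℝ (Fin d) => F (flow F p.1 p.2)) (t, x) :=
    hF.continuous.continuousAt.comp hΦc
  refine ⟨(ContinuousLinearMap.toSpanSingleton ℝ (F (flow F t x))).coprod (A t),
    .of_isLittleO (Asymptotics.isLittleO_iff.2 fun ε hε => ?_)⟩
  have hε3 : 0 < ε / 3 := by positivity
  obtain ⟨δ, hδ, hδA⟩ := eventually_norm_flow_sub_variation_le hF hC hK1 hK hx hT1 hA0 hA hε3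
  obtain ⟨δ₁, hδ₁, h₁⟩ := Metric.continuousAt_iff.1 hFc (ε / 3) hε3
  obtain ⟨δ₂, hδ₂, h₂⟩ := Metric.continuousAt_iff.1 hAc (ε / 3) hε3
  have hT : ∀ᶠ s in 𝓝 t, s ∈ Icc 0 T := Icc_mem_nhds ht.1 ht.2
  obtain ⟨δ₃, hδ₃, h₃⟩ := Metric.eventually_nhds_iff.1 hT
  set ρ := min (min δ δ₁) (min δ₂ δ₃)
  have hρ : 0 < ρ := by positivity
  have hnear : ∀ᶠ p : ℝ × EuclideanSpace ℝ (Fin d) in 𝓝 (t, x),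
      dist p.1 t < ρ ∧ dist p.2 x < ρ := by
    filter_upwards [Metric.ball_mem_nhds (t, x) hρ] with p hp
    simpa [Prod.dist_eq] using hp
  have hnear2 := hnear.prod_nhds hnear
  filter_upwards [hnear2] with q hq
  obtain ⟨⟨hs, hy⟩, hs', hy'⟩ := hq
  obtain ⟨⟨s, y⟩, s', y'⟩ := q
  simp only at hs hy hs' hy' ⊢
  have hle1 : ρ ≤ δ := (min_le_left _ _).trans (min_le_left _ _)
  have hle2 : ρ ≤ δ₁ := (min_le_left _ _).trans (min_le_right _ _)
  have hle3 : ρ ≤ δ₂ := (min_le_right _ _).trans (min_le_left _ _)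
  have hle4 : ρ ≤ δ₃ := (min_le_right _ _).trans (min_le_right _ _)
  have e1 : ‖flow F s y - flow F s' y - (s - s') • F (flow F t x)‖ ≤ ε / 3 * ‖s - s'‖ := by
    have h := (convex_ball t ρ).norm_image_sub_le_of_norm_hasDerivWithin_le
      (f := fun r => flow F r y - r • F (flow F t x)) (x := s') (y := s) (C := ε / 3)
      (f' := fun r => F (flow F r y) - (1 : ℝ) • F (flow F t x))
      (fun r _ => (((flow_spec hF ⟨C, hC⟩ y).2 r).sub
        ((hasDerivAt_id r).smul_const (F (flow F t x)))).hasDerivWithinAt)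
      (fun r hr => by
        rw [one_smul, ← dist_eq_norm]
        refine (h₁ (x := (r, y)) ?_).le
        rw [Prod.dist_eq]
        exact max_lt (lt_of_lt_of_le hr hle2) (hy.trans_le hle2)) hs' hs
    rw [sub_smul, sub_sub_sub_comm]
    exact h
  have e2 := hδA y (hy.trans_le hle1) y' (hy'.trans_le hle1) s' (h₃ (hs'.trans_le hle4))
  have e3 : ‖(A s' - A t) (y - y')‖ ≤ ε / 3 * ‖y - y'‖ := by
    refine (ContinuousLinearMap.le_opNorm _ _).trans ?_
    gcongr
    rw [← dist_eq_norm]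
    exact (h₂ (hs'.trans_le hle3)).le
  have hn1 : ‖s - s'‖ ≤ ‖((s, y) : ℝ × EuclideanSpace ℝ (Fin d)) - (s', y')‖ :=
    norm_fst_le (((s, y) : ℝ × EuclideanSpace ℝ (Fin d)) - (s', y'))
  have hn2 : ‖y - y'‖ ≤ ‖((s, y) : ℝ × EuclideanSpace ℝ (Fin d)) - (s', y')‖ :=
    norm_snd_le (((s, y) : ℝ × EuclideanSpace ℝ (Fin d)) - (s', y'))
  have hdec : flow F s y - flow F s' y' -
      ((ContinuousLinearMap.toSpanSingleton ℝ (F (flow F t x))).coprod (A t)) ((s, y) - (s', y'))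
      = (flow F s y - flow F s' y - (s - s') • F (flow F t x)) +
        (flow F s' y - flow F s' y' - A s' (y - y')) + (A s' - A t) (y - y') := by
    simp only [Prod.mk_sub_mk, ContinuousLinearMap.coprod_apply,
      ContinuousLinearMap.toSpanSingleton_apply, sub_apply]
    abel
  rw [hdec]
  refine (norm_add₃_le).trans ?_
  nlinarith [e1, e2, e3, mul_le_mul_of_nonneg_left hn1 hε3.le, mul_le_mul_of_nonneg_left hn2 hε3.le]

/-- The time `t` flow is an `n`-fold composition of time `t / n` flows, with `t / n < 1 / (2 * K)`.
A single `K` serves for all steps, since the trajectory up to time `t` stays in the open ball of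
radius `‖x‖ + C * t + 1`. -/
theorem hasStrictFDerivAt_flow_of_pos (hF : ContDiff ℝ ∞ F) (hb : ∃ C : ℝ, ∀ x, ‖F x‖ ≤ C)
    {t : ℝ} (ht : 0 < t) (x : EuclideanSpace ℝ (Fin d)) :
    ∃ L : ℝ × EuclideanSpace ℝ (Fin d) →L[ℝ] EuclideanSpace ℝ (Fin d), HasStrictFDerivAt
      (fun p : ℝ × EuclideanSpace ℝ (Fin d) => flow F p.1 p.2) L (t, x) := by
  obtain ⟨C, hC⟩ := hb
  have hC0 : 0 ≤ C := (norm_nonneg _).trans (hC x)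
  obtain ⟨K, hK1, hK⟩ := exists_bound_fderiv hF (‖x‖ + C * t + 1 + C)
  have hK1' : (1 : ℝ) ≤ K := by exact_mod_cast hK1
  obtain ⟨n, hn⟩ := exists_nat_gt (t * (2 * K))
  have hn0 : (0 : ℝ) < n := lt_trans (by positivity) hn
  have key : ∀ k : ℕ, k ≤ n → ∃ L : ℝ × EuclideanSpace ℝ (Fin d) →L[ℝ] EuclideanSpace ℝ (Fin d), HasStrictFDerivAt
      (fun p : ℝ × EuclideanSpace ℝ (Fin d) => flow F (k * (p.1 / n)) p.2) L (t, x) := by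
    intro k
    induction k with
    | zero =>
      intro _
      have : (fun p : ℝ × EuclideanSpace ℝ (Fin d) => flow F ((0 : ℕ) * (p.1 / n)) p.2) =
          Prod.snd := by
        funext p; simp [(flow_spec hF ⟨C, hC⟩ p.2).1]
      rw [this]
      exact ⟨_, hasStrictFDerivAt_snd⟩
    | succ k ih =>
      intro hk
      obtain ⟨L, hL⟩ := ih (by omega)
      have hkn : (k : ℝ) ≤ n := by exact_mod_cast (by omega : k ≤ n)
      have hR : ‖flow F (k * (t / n)) x‖ < ‖x‖ + C * t + 1 := by
        have h := dist_flow_le hF hC 0 (k * (t / n)) x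
        rw [(flow_spec hF ⟨C, hC⟩ x).1, sub_zero, abs_of_nonneg (by positivity), dist_eq_norm] at h
        have h1 := norm_add_le x (flow F (k * (t / n)) x - x)
        rw [add_sub_cancel] at h1
        have h2 : (k : ℝ) * (t / n) ≤ t := by
          rw [mul_div_assoc', div_le_iff₀ hn0]; nlinarith
        nlinarith
      obtain ⟨L', hL'⟩ := hasStrictFDerivAt_flow_short hF hC hK1 hK hR (t := t / n)
        ⟨by positivity, by rw [div_lt_div_iff₀ hn0 (by positivity)]; linarith⟩
      have hdiv : HasStrictFDerivAt (fun p : ℝ × EuclideanSpace ℝ (Fin d) => p.1 / n)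
          ((n : ℝ)⁻¹ • ContinuousLinearMap.fst ℝ ℝ (EuclideanSpace ℝ (Fin d))) (t, x) := by
        have h := (hasStrictFDerivAt_fst (𝕜 := ℝ) (E := ℝ) (F := EuclideanSpace ℝ (Fin d))
          (p := (t, x))).const_smul (n : ℝ)⁻¹
        refine h.congr_of_eventuallyEq (.of_forall fun p => ?_)
        simp [div_eq_inv_mul]
      have hcomp := HasStrictFDerivAt.comp (t, x)
        (g := fun p : ℝ × EuclideanSpace ℝ (Fin d) => flow F p.1 p.2)
        (f := fun p : ℝ × EuclideanSpace ℝ (Fin d) => (p.1 / n, flow F (k * (p.1 / n)) p.2))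
        hL' (hdiv.prodMk hL)
      refine ⟨_, hcomp.congr_of_eventuallyEq (.of_forall fun p => ?_)⟩
      simp only
      rw [← flow_add hF ⟨C, hC⟩]
      push_cast
      ring_nf
  obtain ⟨L, hL⟩ := key n le_rfl
  refine ⟨L, hL.congr_of_eventuallyEq (.of_forall fun p => ?_)⟩
  simp only
  rw [mul_div_cancel₀ _ hn0.ne']

/-- The flow of a smooth bounded field is jointly strictly differentiable in time and space. -/
theorem exists_hasStrictFDerivAt_flow (hF : ContDiff ℝ ∞ F) (hb : ∃ C : ℝ, ∀ x, ‖F x‖ ≤ C)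
    (q : ℝ × EuclideanSpace ℝ (Fin d)) :
    ∃ L : ℝ × EuclideanSpace ℝ (Fin d) →L[ℝ] EuclideanSpace ℝ (Fin d), HasStrictFDerivAt
      (fun p : ℝ × EuclideanSpace ℝ (Fin d) => flow F p.1 p.2) L q := by
  obtain ⟨t, x⟩ := q
  have hb' : ∃ C : ℝ, ∀ x, ‖(-F) x‖ ≤ C := by simpa using hb
  -- The flow is decomposed into going back by `|t| + 1`, along the forward flow of `-F`, then
  -- forward by `t + (|t| + 1)`. Both times are positive, whatever the sign of `t`.
  have hr : 0 < |t| + 1 := by positivity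
  obtain ⟨L, hL⟩ := hasStrictFDerivAt_flow_of_pos hF.neg hb' hr x
  obtain ⟨L', hL'⟩ := hasStrictFDerivAt_flow_of_pos hF hb
    (t := t + (|t| + 1)) (by linarith [neg_abs_le t]) (flow (-F) (|t| + 1) x)
  have hin : HasStrictFDerivAt (fun p : ℝ × EuclideanSpace ℝ (Fin d) => (|t| + 1, p.2))
      ((0 : ℝ × EuclideanSpace ℝ (Fin d) →L[ℝ] ℝ).prod (ContinuousLinearMap.snd ℝ _ _)) (t, x) :=
    (hasStrictFDerivAt_const _ _).prodMk hasStrictFDerivAt_snd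
  have h1 := HasStrictFDerivAt.comp (t, x)
    (g := fun p : ℝ × EuclideanSpace ℝ (Fin d) => flow (-F) p.1 p.2) hL hin
  have h2 := (hasStrictFDerivAt_fst (𝕜 := ℝ) (E := ℝ) (F := EuclideanSpace ℝ (Fin d))
          (p := (t, x))).add_const (|t| + 1)
  have h3 := HasStrictFDerivAt.comp (t, x)
    (g := fun p : ℝ × EuclideanSpace ℝ (Fin d) => flow F p.1 p.2) hL' (h2.prodMk h1)
  refine ⟨_, h3.congr_of_eventuallyEq (.of_forall fun p => ?_)⟩
  simp only
  rw [flow_neg_field hF hb, ← flow_add hF hb]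
  ring_nf

end FlowStrictDeriv

/-! ### Images of Lebesgue measure under submersions -/

section LocalSubmersion

/-- Near `u` the map `f - L` is Lipschitz with constant `ε / 2`, which bounds its derivative at
every nearby point. -/
theorem HasStrictFDerivAt.continuousAt_fderiv {W E : Type*} [NormedAddCommGroup W] [NormedSpace ℝ W]
    [NormedAddCommGroup E] [NormedSpace ℝ E] {f : W → E} {L : W →L[ℝ] E} {u : W}
    (hf : HasStrictFDerivAt f L u) (hd : ∀ᶠ v in 𝓝 u, DifferentiableAt ℝ f v) :
    ContinuousAt (fderiv ℝ f) u := by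
  refine Metric.continuousAt_iff'.2 fun ε hε => ?_
  have h := Asymptotics.isLittleO_iff.1 hf.isLittleO (half_pos hε)
  obtain ⟨δ, hδ, hB⟩ := Metric.eventually_nhds_iff_ball.1 h
  filter_upwards [hd, Metric.ball_mem_nhds u hδ] with v hv hvδ
  rw [hf.hasFDerivAt.fderiv, dist_eq_norm]
  refine (HasFDerivAt.le_of_lip' (hv.hasFDerivAt.sub L.hasFDerivAt) (half_pos hε).le ?_).trans_lt
    (half_lt_self hε)
  filter_upwards [Metric.isOpen_ball.mem_nhds hvδ] with w hw
  have := hB (w, v) (by rw [← ball_prod_same]; exact ⟨hw, hvδ⟩)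
  rwa [map_sub, sub_sub_sub_comm] at this

/-- If `R'` is a right inverse of `L`, then `L'.comp R'` is close to the identity, hence invertible,
for `L'` close to `L`. -/
theorem ContinuousLinearMap.eventually_surjective {W E : Type*} [NormedAddCommGroup W]
    [NormedSpace ℝ W] [NormedAddCommGroup E] [NormedSpace ℝ E] [FiniteDimensional ℝ E]
    {L : W →L[ℝ] E} (hL : Function.Surjective L) :
    ∀ᶠ L' : W →L[ℝ] E in 𝓝 L, Function.Surjective L' := by
  have : CompleteSpace E := FiniteDimensional.complete ℝ E
  obtain ⟨R, hR⟩ := LinearMap.exists_rightInverse_of_surjective (L : W →ₗ[ℝ] E)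
    (LinearMap.range_eq_top.2 hL)
  let R' : E →L[ℝ] W := LinearMap.toContinuousLinearMap R
  have hcont : Continuous fun L' : W →L[ℝ] E => L'.comp R' := by fun_prop
  have hu : IsUnit (L.comp R') := by
    have : L.comp R' = 1 := by
      ext a
      exact LinearMap.congr_fun hR a
    rw [this]
    exact isUnit_one
  filter_upwards [hcont.continuousAt (Units.isOpen.mem_nhds hu)] with L' hL' y
  obtain ⟨U, hU⟩ := hL'
  refine ⟨R' ((↑U⁻¹ : E →L[ℝ] E) y), ?_⟩
  have h1 : (U : E →L[ℝ] E) * (↑U⁻¹ : E →L[ℝ] E) = 1 := U.mul_inv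
  rw [hU] at h1
  exact DFunLike.congr_fun h1 y

/-- A map with strict derivative that is the identity along the directions of `R` satisfies the
hypotheses of `measure_mul_measure_inter_ball_le`, uniformly in a parameter. -/
theorem HasStrictFDerivAt.exists_approximatesLinearOn {E W P : Type*}
    [NormedAddCommGroup E] [NormedSpace ℝ E] [NormedAddCommGroup W] [NormedSpace ℝ W]
    [NormedAddCommGroup P]
    [NormedSpace ℝ P] {G : P × W → E} {L : P × W →L[ℝ] E} {p₀ : P} {w₀ : W}
    (hG : HasStrictFDerivAt G L (p₀, w₀)) (R : E →L[ℝ] W) (hR : ∀ a, L (0, R a) = a)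
    {δ : ℝ≥0} (hδ : 0 < δ) {r : ℝ} (hr : 0 < r) :
    ∃ ρ > 0, ∃ η > 0, η ≤ r ∧ (∀ a ∈ Metric.closedBall (0 : E) ρ, ‖R a‖ ≤ r) ∧
      ∀ᶠ p in 𝓝 p₀, ∀ v ∈ Metric.ball w₀ η,
        ApproximatesLinearOn (fun a => G (p, v + R a)) (ContinuousLinearMap.id ℝ E)
          (Metric.closedBall 0 ρ) δ ∧ dist (G (p, v)) (G (p₀, w₀)) ≤ ρ / 4 := by
  have hRn : 0 < ‖R‖ + 1 := by positivity
  have h := Asymptotics.isLittleO_iff.1 hG.isLittleO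
    (show (0 : ℝ) < δ / (‖R‖ + 1) by positivity)
  obtain ⟨ε, hε, hB⟩ := Metric.eventually_nhds_iff_ball.1 h
  set ρ := min r (ε / 2) / (‖R‖ + 1)
  have hρ : 0 < ρ := by positivity
  have hRρ : ∀ a ∈ Metric.closedBall (0 : E) ρ, ‖R a‖ ≤ min r (ε / 2) := by
    intro a ha
    rw [mem_closedBall_zero_iff] at ha
    calc ‖R a‖ ≤ ‖R‖ * ‖a‖ := R.le_opNorm a
      _ ≤ (‖R‖ + 1) * (min r (ε / 2) / (‖R‖ + 1)) := by
          gcongr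
          linarith
      _ = min r (ε / 2) := mul_div_cancel₀ _ hRn.ne'
  have hc : ∀ᶠ q in 𝓝 (p₀, w₀), dist (G q) (G (p₀, w₀)) < ρ / 4 :=
    hG.continuousAt.eventually (Metric.ball_mem_nhds _ (by positivity))
  obtain ⟨ε', hε', hB'⟩ := Metric.eventually_nhds_iff_ball.1 hc
  refine ⟨ρ, hρ, min r (min (ε / 2) ε'), by positivity,
    min_le_left _ _,
    fun a ha => (hRρ a ha).trans (min_le_left _ _), ?_⟩
  filter_upwards [Metric.ball_mem_nhds p₀ hε, Metric.ball_mem_nhds p₀ hε'] with p hp hp' v hv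
  have hv1 : dist v w₀ < ε / 2 :=
    (Metric.mem_ball.1 hv).trans_le ((min_le_right _ _).trans (min_le_left _ _))
  have hv2 : dist v w₀ < ε' :=
    (Metric.mem_ball.1 hv).trans_le ((min_le_right _ _).trans (min_le_right _ _))
  refine ⟨fun a ha b hb => ?_, (hB' (p, v) ?_).le⟩
  · have hmem : ∀ a ∈ Metric.closedBall (0 : E) ρ, (p, v + R a) ∈ Metric.ball (p₀, w₀) ε := by
      intro a ha
      rw [← ball_prod_same]
      refine ⟨hp, ?_⟩
      rw [Metric.mem_ball, dist_eq_norm, add_sub_right_comm]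
      refine (norm_add_le _ _).trans_lt ?_
      rw [← dist_eq_norm]
      linarith [(hRρ a ha).trans (min_le_right _ _)]
    have h := hB ((p, v + R a), (p, v + R b)) (by
      rw [← ball_prod_same]; exact ⟨hmem a ha, hmem b hb⟩)
    have e : ((p, v + R a) : P × W) - (p, v + R b) = (0, R (a - b)) := by
      simp [map_sub]
    simp only [e, hR] at h
    refine h.trans ?_
    have hn : ‖((0 : P), R (a - b))‖ ≤ ‖R‖ * ‖a - b‖ := by
      rw [Prod.norm_def]; simpa using R.le_opNorm (a - b)
    calc (δ : ℝ) / (‖R‖ + 1) * ‖((0 : P), R (a - b))‖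
        ≤ δ / (‖R‖ + 1) * ((‖R‖ + 1) * ‖a - b‖) := by
          gcongr
          exact hn.trans (by gcongr; linarith)
      _ = δ * ‖a - b‖ := by field_simp
  · rw [← ball_prod_same]; exact ⟨hp', hv2⟩

variable {E : Type*} [NormedAddCommGroup E] [NormedSpace ℝ E] [FiniteDimensional ℝ E]
  [MeasurableSpace E] [BorelSpace E] (ν : Measure E) [ν.IsAddHaarMeasure]

/-- A map close to the identity on a ball pulls back volume with a lower bound. -/
theorem exists_measure_inter_ball_le_preimage :
    ∃ δ : ℝ≥0, 0 < δ ∧ ∀ (g : E → E) (ρ : ℝ) (z : E), 0 ≤ ρ →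
      ApproximatesLinearOn g (ContinuousLinearMap.id ℝ E) (Metric.closedBall 0 ρ) δ →
      dist (g 0) z ≤ ρ / 4 → ∀ A : Set E,
        ν (A ∩ Metric.ball z (ρ / 4)) ≤ 2 * ν (g ⁻¹' A ∩ Metric.closedBall 0 ρ) := by
  have hdet : ENNReal.ofReal |(ContinuousLinearMap.id ℝ E).det| < ((2 : ℝ≥0) : ℝ≥0∞) := by
    have : (ContinuousLinearMap.id ℝ E).det = 1 := by
      simp [ContinuousLinearMap.det]
    rw [this]; simp
  have h1 := addHaar_image_le_mul_of_det_lt ν _ hdet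
  have h2 : ∀ᶠ δ : ℝ≥0 in 𝓝[>] 0, δ < 1 / 2 :=
    nhdsWithin_le_nhds (Iio_mem_nhds (by positivity))
  obtain ⟨δ, ⟨hδ, hδ2⟩, hδ0⟩ := ((h1.and h2).and self_mem_nhdsWithin).exists
  refine ⟨δ, hδ0, fun g ρ z hρ hg hz A => ?_⟩
  let inv : (ContinuousLinearMap.id ℝ E).NonlinearRightInverse :=
    { toFun := id, nnnorm := 1, bound' := fun y => by simp, right_inv' := fun y => rfl }
  -- The image contains the ball about `g 0` of radius `(1 - δ) * ρ ≥ ρ / 2`, hence `ball z (ρ /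
  -- 4)`. By the choice of `δ`, `g` at most doubles volumes, as the identity has determinant `1 <
  -- 2`.
  have hsurj := hg.surjOn_closedBall_of_nonlinearRightInverse inv hρ subset_rfl
  have hsub : A ∩ Metric.ball z (ρ / 4) ⊆ g '' (g ⁻¹' A ∩ Metric.closedBall 0 ρ) := by
    rintro y ⟨hyA, hy⟩
    have hy2 : y ∈ Metric.closedBall (g 0) ((((1 : ℝ≥0) : ℝ)⁻¹ - δ) * ρ) := by
      rw [Metric.mem_closedBall]
      have h3 := dist_triangle y z (g 0)
      rw [dist_comm z] at h3
      have h4 : (δ : ℝ) < 1 / 2 := by exact_mod_cast hδ2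
      rw [Metric.mem_ball] at hy
      simp only [NNReal.coe_one, inv_one]
      nlinarith
    obtain ⟨a, ha, rfl⟩ := hsurj hy2
    exact ⟨a, ⟨hyA, ha⟩, rfl⟩
  refine (measure_mono hsub).trans ?_
  exact hδ _ _ (hg.mono_set inter_subset_right)

variable {W : Type*} [NormedAddCommGroup W] [NormedSpace ℝ W] [FiniteDimensional ℝ W]
  [MeasurableSpace W] [BorelSpace W] (μ : Measure W) [μ.IsAddHaarMeasure]

/-- Averaging over the translates `v + R a`: a map that is close to the identity along the
directions of `R` pushes volume to a measure bounded below by volume. -/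
theorem measure_mul_measure_inter_ball_le {δ : ℝ≥0}
    (hδ : ∀ (g : E → E) (ρ : ℝ) (z : E), 0 ≤ ρ →
      ApproximatesLinearOn g (ContinuousLinearMap.id ℝ E) (Metric.closedBall 0 ρ) δ →
      dist (g 0) z ≤ ρ / 4 → ∀ A : Set E,
        ν (A ∩ Metric.ball z (ρ / 4)) ≤ 2 * ν (g ⁻¹' A ∩ Metric.closedBall 0 ρ))
    {f : W → E} (hf : Measurable f) (R : E →L[ℝ] W) {K Ω : Set W} (hK : MeasurableSet K)
    {ρ : ℝ} (hρ : 0 ≤ ρ) {z : E}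
    (hKΩ : ∀ v ∈ K, ∀ a ∈ Metric.closedBall (0 : E) ρ, v + R a ∈ Ω)
    (happ : ∀ v ∈ K, ApproximatesLinearOn (fun a => f (v + R a)) (ContinuousLinearMap.id ℝ E)
      (Metric.closedBall 0 ρ) δ)
    (hz : ∀ v ∈ K, dist (f v) z ≤ ρ / 4) {A : Set E} (hA : MeasurableSet A) :
    μ K * ν (A ∩ Metric.ball z (ρ / 4)) ≤
      2 * ν (Metric.closedBall 0 ρ) * μ (Ω ∩ f ⁻¹' A) := by
  have : ProperSpace W := FiniteDimensional.proper_real W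
  -- The product measure of `S` is estimated twice: from above by slices with `a` fixed, using
  -- translation invariance of `μ`, and from below by slices with `v` fixed, using `hδ`.
  let S : Set (E × W) := {p | f (p.2 + R p.1) ∈ A}
  have hS : MeasurableSet S := by
    refine (hf.comp ?_) hA
    exact measurable_snd.add (R.continuous.measurable.comp measurable_fst)
  have hup : ((ν.restrict (Metric.closedBall 0 ρ)).prod (μ.restrict K)) S ≤
      ν (Metric.closedBall 0 ρ) * μ (Ω ∩ f ⁻¹' A) := by
    rw [Measure.prod_apply hS, mul_comm, ← setLIntegral_const]
    refine setLIntegral_mono' Metric.isClosed_closedBall.measurableSet fun a ha => ?_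
    rw [Measure.restrict_apply (measurable_prodMk_left hS),
      ← measure_preimage_add_right μ (R a) (Ω ∩ f ⁻¹' A)]
    exact measure_mono fun v hv => ⟨hKΩ v hv.2 a ha, hv.1⟩
  have hlow : μ K * ν (A ∩ Metric.ball z (ρ / 4)) ≤
      2 * ((ν.restrict (Metric.closedBall 0 ρ)).prod (μ.restrict K)) S := by
    rw [Measure.prod_apply_symm hS, ← lintegral_const_mul' _ _ (by simp), mul_comm,
      ← setLIntegral_const]
    refine setLIntegral_mono' hK fun v hv => ?_
    rw [Measure.restrict_apply (measurable_prodMk_right hS)]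
    exact hδ (fun a => f (v + R a)) ρ z hρ (happ v hv) (by simpa using hz v hv) A
  refine hlow.trans ?_
  rw [mul_assoc]
  gcongr

end LocalSubmersion

/-! ### Endpoints of trajectories and the probability of their jumps -/

namespace SwitchedSystem

section CompositeFlow

variable {d : ℕ} {E : Type*} [Fintype E] (S : SwitchedSystem d E)

theorem bounded_field (i : E) : ∃ C : ℝ, ∀ x, ‖S.F i x‖ ≤ C :=
  S.bounded.imp fun _ h => h i

theorem Phi_zero (i : E) (x : EuclideanSpace ℝ (Fin d)) : S.Phi i 0 x = x :=
  (flow_spec (S.smooth i) (S.bounded_field i) x).1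

theorem Phi_add (i : E) (s t : ℝ) (x : EuclideanSpace ℝ (Fin d)) :
    S.Phi i (s + t) x = S.Phi i s (S.Phi i t x) :=
  flow_add (S.smooth i) (S.bounded_field i) s t x

theorem exists_hasStrictFDerivAt_Phi (i : E) (q : ℝ × EuclideanSpace ℝ (Fin d)) :
    ∃ L : ℝ × EuclideanSpace ℝ (Fin d) →L[ℝ] EuclideanSpace ℝ (Fin d), HasStrictFDerivAt
      (fun p : ℝ × EuclideanSpace ℝ (Fin d) => S.Phi i p.1 p.2) L q :=
  exists_hasStrictFDerivAt_flow (S.smooth i) (S.bounded_field i) q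

theorem continuous_Phi (i : E) :
    Continuous fun p : ℝ × EuclideanSpace ℝ (Fin d) => S.Phi i p.1 p.2 :=
  continuous_iff_continuousAt.2 fun q =>
    (S.exists_hasStrictFDerivAt_Phi i q).choose_spec.continuousAt

theorem exists_hasStrictFDerivAt_Phi_comp {W : Type*} [NormedAddCommGroup W] [NormedSpace ℝ W]
    (i : E) {a : W → ℝ} {f : W → EuclideanSpace ℝ (Fin d)} {w : W}
    (ha : ∃ L : W →L[ℝ] ℝ, HasStrictFDerivAt a L w)
    (hf : ∃ L : W →L[ℝ] EuclideanSpace ℝ (Fin d), HasStrictFDerivAt f L w) :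
    ∃ L : W →L[ℝ] EuclideanSpace ℝ (Fin d),
      HasStrictFDerivAt (fun w => S.Phi i (a w) (f w)) L w := by
  obtain ⟨La, ha⟩ := ha
  obtain ⟨Lf, hf⟩ := hf
  obtain ⟨L, hL⟩ := S.exists_hasStrictFDerivAt_Phi i (a w, f w)
  exact ⟨_, HasStrictFDerivAt.comp w
    (g := fun p : ℝ × EuclideanSpace ℝ (Fin d) => S.Phi i p.1 p.2) (f := fun w => (a w, f w))
    hL (ha.prodMk hf)⟩

theorem exists_hasStrictFDerivAt_compositeFlow {W : Type*} [NormedAddCommGroup W]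
    [NormedSpace ℝ W] {n : ℕ} (j : Fin (n + 1) → E) {τ : W → Fin n → ℝ}
    {f : W → EuclideanSpace ℝ (Fin d)} {w : W}
    (hτ : ∀ k, ∃ L : W →L[ℝ] ℝ, HasStrictFDerivAt (fun w => τ w k) L w)
    (hf : ∃ L : W →L[ℝ] EuclideanSpace ℝ (Fin d), HasStrictFDerivAt f L w) :
    ∃ L : W →L[ℝ] EuclideanSpace ℝ (Fin d),
      HasStrictFDerivAt (fun w => S.compositeFlow j (τ w) (f w)) L w := by
  induction n with
  | zero => exact hf
  | succ n ih =>
    exact S.exists_hasStrictFDerivAt_Phi_comp _ (hτ (Fin.last n))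
      (ih (Fin.init j) (τ := fun w => Fin.init (τ w)) fun k => hτ k.castSucc)

/-- The endpoint at time `t` of the trajectory with jumps after the sojourn times `τ`. -/
noncomputable def endpoint {n : ℕ} (j : Fin (n + 1) → E)
    (q : (EuclideanSpace ℝ (Fin d) × ℝ) × (Fin n → ℝ)) : EuclideanSpace ℝ (Fin d) :=
  S.Phi (j (Fin.last n)) (q.1.2 - ∑ k, q.2 k) (S.compositeFlow j q.2 q.1.1)

theorem exists_hasStrictFDerivAt_endpoint {n : ℕ} (j : Fin (n + 1) → E)
    (q : (EuclideanSpace ℝ (Fin d) × ℝ) × (Fin n → ℝ)) :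
    ∃ L : (EuclideanSpace ℝ (Fin d) × ℝ) × (Fin n → ℝ) →L[ℝ] EuclideanSpace ℝ (Fin d),
      HasStrictFDerivAt (S.endpoint j) L q := by
  have hk : ∀ k, HasStrictFDerivAt
      (fun q : (EuclideanSpace ℝ (Fin d) × ℝ) × (Fin n → ℝ) => q.2 k)
      ((ContinuousLinearMap.proj k).comp (ContinuousLinearMap.snd ℝ _ _)) q := fun k =>
    ((ContinuousLinearMap.proj (R := ℝ) (φ := fun _ : Fin n => ℝ) k).comp
      (ContinuousLinearMap.snd ℝ (EuclideanSpace ℝ (Fin d) × ℝ) (Fin n → ℝ))).hasStrictFDerivAt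
  have ht : HasStrictFDerivAt
      (fun q : (EuclideanSpace ℝ (Fin d) × ℝ) × (Fin n → ℝ) => q.1.2)
      ((ContinuousLinearMap.snd ℝ _ _).comp (ContinuousLinearMap.fst ℝ _ _)) q :=
    ((ContinuousLinearMap.snd ℝ (EuclideanSpace ℝ (Fin d)) ℝ).comp
      (ContinuousLinearMap.fst ℝ _ (Fin n → ℝ))).hasStrictFDerivAt
  have hx : HasStrictFDerivAt
      (fun q : (EuclideanSpace ℝ (Fin d) × ℝ) × (Fin n → ℝ) => q.1.1)
      ((ContinuousLinearMap.fst ℝ _ _).comp (ContinuousLinearMap.fst ℝ _ _)) q :=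
    ((ContinuousLinearMap.fst ℝ (EuclideanSpace ℝ (Fin d)) ℝ).comp
      (ContinuousLinearMap.fst ℝ _ (Fin n → ℝ))).hasStrictFDerivAt
  exact S.exists_hasStrictFDerivAt_Phi_comp _
    ⟨_, ht.sub (HasStrictFDerivAt.fun_sum fun k _ => hk k)⟩
    (S.exists_hasStrictFDerivAt_compositeFlow j (fun k => ⟨_, hk k⟩) ⟨_, hx⟩)

theorem continuous_endpoint {n : ℕ} (j : Fin (n + 1) → E) : Continuous (S.endpoint j) :=
  continuous_iff_continuousAt.2 fun q =>
    (S.exists_hasStrictFDerivAt_endpoint j q).choose_spec.continuousAt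

/-- The composite flow for nonnegative times, as a map of `M` to itself. -/
noncomputable def compositeFlowM : {n : ℕ} → (Fin (n + 1) → E) → (Fin n → ℝ) → S.M → S.M
  | 0, _, _, x => x
  | n + 1, j, τ, x =>
      S.flowM (j (Fin.last n).castSucc) (τ (Fin.last n)).toNNReal
        (compositeFlowM (Fin.init j) (Fin.init τ) x)

theorem coe_compositeFlowM {n : ℕ} (j : Fin (n + 1) → E) {τ : Fin n → ℝ} (hτ : ∀ k, 0 ≤ τ k)
    (x : S.M) : (S.compositeFlowM j τ x : EuclideanSpace ℝ (Fin d)) = S.compositeFlow j τ x := by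
  induction n with
  | zero => rfl
  | succ n ih =>
    have h := ih (Fin.init j) (τ := Fin.init τ) fun k => hτ k.castSucc
    simp only [compositeFlowM, compositeFlow, flowM, h, Real.coe_toNNReal _ (hτ (Fin.last n))]

theorem continuous_flowM (i : E) : Continuous fun p : ℝ≥0 × S.M => S.flowM i p.1 p.2 :=
  ((S.continuous_Phi i).comp ((NNReal.continuous_coe.comp continuous_fst).prodMk
    (continuous_subtype_val.comp continuous_snd))).subtype_mk _

theorem continuous_compositeFlowM {n : ℕ} (j : Fin (n + 1) → E) :
    Continuous fun p : S.M × (Fin n → ℝ) => S.compositeFlowM j p.2 p.1 := by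
  induction n with
  | zero => exact continuous_fst
  | succ n ih =>
    have h1 : Continuous fun p : S.M × (Fin (n + 1) → ℝ) =>
        ((p.1, Fin.init p.2) : S.M × (Fin n → ℝ)) :=
      continuous_fst.prodMk (continuous_pi fun k => (continuous_apply _).comp continuous_snd)
    have h2 : Continuous fun p : S.M × (Fin (n + 1) → ℝ) => (p.2 (Fin.last n)).toNNReal :=
      continuous_real_toNNReal.comp ((continuous_apply _).comp continuous_snd)
    exact (S.continuous_flowM _).comp (h2.prodMk ((ih (Fin.init j)).comp h1))

variable [DecidableEq E]

/-- Along all trajectories from `x` with sojourn times in the box `s`, the jumps prescribed by `j`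
have probability at least `p`. -/
def JumpsLikely (p : ℝ) (x : S.M) : {n : ℕ} → (Fin (n + 1) → E) → (Fin n → Set ℝ) → Prop
  | 0, _, _ => True
  | n + 1, j, s => JumpsLikely p x (Fin.init j) (Fin.init s) ∧
      ∀ τ ∈ Set.pi univ s,
        p ≤ S.Q (S.compositeFlowM j τ x) (j (Fin.last n).castSucc) (j (Fin.last (n + 1)))

/-- The jumps prescribed by `j` have positive probability along the trajectory from `x` with
sojourn times `τ`. -/
def JumpsPossible (x : S.M) : {n : ℕ} → (Fin (n + 1) → E) → (Fin n → ℝ) → Prop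
  | 0, _, _ => True
  | n + 1, j, τ => JumpsPossible x (Fin.init j) (Fin.init τ) ∧
      0 < S.Q (S.compositeFlowM j τ x) (j (Fin.last n).castSucc) (j (Fin.last (n + 1)))

variable {S}

theorem JumpsLikely.mono {p p' : ℝ} (hp : p' ≤ p) {x : S.M} {n : ℕ} {j : Fin (n + 1) → E}
    {s s' : Fin n → Set ℝ} (hs : ∀ k, s' k ⊆ s k) (h : S.JumpsLikely p x j s) :
    S.JumpsLikely p' x j s' := by
  induction n with
  | zero => trivial
  | succ n ih =>
    exact ⟨ih (fun k => hs k.castSucc) h.1, fun τ hτ =>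
      hp.trans (h.2 τ fun k _ => hs k (hτ k (mem_univ k)))⟩

/-- `Q` is continuous along `compositeFlowM`, jointly in the starting point and the sojourn times,
so half its value at the centre is a local lower bound. Negative times in the balls are harmless:
`compositeFlowM` truncates them at zero. -/
theorem JumpsPossible.exists_jumpsLikely {x₀ : S.M} {n : ℕ} {j : Fin (n + 1) → E}
    {τ : Fin n → ℝ} (h : S.JumpsPossible x₀ j τ) :
    ∃ p > 0, ∃ r > 0, ∀ᶠ x in 𝓝 x₀, S.JumpsLikely p x j fun k => Metric.ball (τ k) r := by
  induction n with
  | zero => exact ⟨1, one_pos, 1, one_pos, .of_forall fun _ => trivial⟩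
  | succ n ih =>
    obtain ⟨p, hp, r, hr, hev⟩ := ih h.1
    have hpos := h.2
    set q := S.Q (S.compositeFlowM j τ x₀) (j (Fin.last n).castSucc) (j (Fin.last (n + 1)))
    have hc : Continuous fun z : S.M × (Fin (n + 1) → ℝ) => S.Q (S.compositeFlowM j z.2 z.1)
        (j (Fin.last n).castSucc) (j (Fin.last (n + 1))) :=
      (S.continuous_Q _ _).comp (S.continuous_compositeFlowM j)
    have hq : ∀ᶠ z in 𝓝 (x₀, τ), q / 2 < S.Q (S.compositeFlowM j z.2 z.1)
        (j (Fin.last n).castSucc) (j (Fin.last (n + 1))) :=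
      (hc.tendsto (x₀, τ)).eventually_const_lt (half_lt_self hpos)
    obtain ⟨r', hr', hB⟩ := Metric.eventually_nhds_iff_ball.1 hq
    refine ⟨min p (q / 2), lt_min hp (half_pos hpos), min r r', lt_min hr hr', ?_⟩
    filter_upwards [hev, Metric.ball_mem_nhds x₀ hr'] with x hx hx'
    refine ⟨hx.mono (min_le_left _ _) fun k => Metric.ball_subset_ball (min_le_left _ _),
      fun σ hσ => (min_le_right _ _).trans (hB (x, σ) ?_).le⟩
    rw [← ball_prod_same]
    refine ⟨hx', ?_⟩
    rw [Metric.mem_ball, dist_pi_lt_iff hr']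
    exact fun k => (Metric.mem_ball.1 (hσ k (mem_univ k))).trans_le (min_le_right _ _)

end CompositeFlow

/-! ### Lower bounds for the law of the chain and of the process -/

section LowerBound

theorem setLIntegral_pi_snoc {n : ℕ} {s : Fin (n + 1) → Set ℝ}
    {φ : (Fin (n + 1) → ℝ) → ℝ≥0∞} (hφ : Measurable φ) :
    ∫⁻ τ in Set.pi univ s, φ τ =
      ∫⁻ τ in Set.pi univ (Fin.init s), ∫⁻ u in s (Fin.last n), φ (Fin.snoc τ u) := by
  have hmp := (measurePreserving_piFinSuccAbove (fun k => (volume : Measure ℝ).restrict (s k))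
    (Fin.last n)).symm
  have hm : Measurable fun a =>
      φ ((MeasurableEquiv.piFinSuccAbove (fun _ => ℝ) (Fin.last n)).symm a) :=
    hφ.comp (MeasurableEquiv.measurable _)
  rw [volume_pi, Measure.restrict_pi_pi, ← hmp.lintegral_comp hφ,
    lintegral_prod_symm _ hm.aemeasurable, volume_pi, Measure.restrict_pi_pi]
  simp only [Fin.succAbove_last, MeasurableEquiv.piFinSuccAbove_symm_apply]
  refine lintegral_congr fun τ => lintegral_congr fun u => congrArg φ ?_
  exact Fin.insertNth_last' u τ

variable {d : ℕ} {E : Type*} [Fintype E] (S : SwitchedSystem d E)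

/-- The exponential density is decreasing on `[0, T]`, so it is at least its value at `T`. -/
theorem le_lintegral_waitingLaw {T : ℝ} {s : Set ℝ} (hs : MeasurableSet s) (hsT : s ⊆ Icc 0 T)
    {g : ℝ≥0 → ℝ≥0∞} (hg : Measurable g) :
    ENNReal.ofReal (S.lam * Real.exp (-(S.lam * T))) * ∫⁻ u in s, g u.toNNReal ≤
      ∫⁻ u, g u ∂S.waitingLaw := by
  have hpdf : Measurable (gammaPDF 1 S.lam) := (measurable_gammaPDFReal 1 S.lam).ennreal_ofReal
  have hg' : Measurable fun u : ℝ => g u.toNNReal := hg.comp measurable_real_toNNReal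
  rw [waitingLaw, lintegral_map hg measurable_real_toNNReal, expMeasure, gammaMeasure,
    lintegral_withDensity_eq_lintegral_mul _ hpdf hg',
    ← lintegral_const_mul' _ _ ENNReal.ofReal_ne_top]
  refine le_trans (setLIntegral_mono' hs fun u hu => ?_) (setLIntegral_le_lintegral s _)
  simp only [Pi.mul_apply]
  gcongr
  change _ ≤ exponentialPDF S.lam u
  rw [exponentialPDF_of_nonneg (hsT hu).1]
  have := S.lam_pos
  gcongr
  exact (hsT hu).2

/-- The density bound is applied on the interval `(T, T + 1]`, of length one. -/
theorem le_waitingLaw_Ioi {t T : ℝ≥0} (ht : t ≤ T) :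
    ENNReal.ofReal (S.lam * Real.exp (-(S.lam * (T + 1)))) ≤ S.waitingLaw (Ioi t) := by
  have h := S.le_lintegral_waitingLaw (T := T + 1) (s := Ioc (T : ℝ) (T + 1)) measurableSet_Ioc
    (fun u hu => ⟨T.2.trans hu.1.le, hu.2⟩) (g := (Ioi t).indicator 1)
    (measurable_one.indicator measurableSet_Ioi)
  rw [lintegral_indicator_one measurableSet_Ioi] at h
  refine le_trans ?_ h
  have h1 : ∫⁻ u in Ioc (T : ℝ) (T + 1), (Ioi t).indicator (1 : ℝ≥0 → ℝ≥0∞) u.toNNReal =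
      ∫⁻ _ in Ioc (T : ℝ) (T + 1), 1 := by
    refine setLIntegral_congr_fun measurableSet_Ioc fun u hu => ?_
    refine indicator_of_mem (s := Ioi t) (f := (1 : ℝ≥0 → ℝ≥0∞)) ?_
    rw [mem_Ioi, Real.lt_toNNReal_iff_coe_lt]
    exact lt_of_le_of_lt (NNReal.coe_le_coe.2 ht) hu.1
  rw [h1]
  simp

theorem Z_eq {n : ℕ} {t : ℝ≥0} {w : ℕ → ℝ≥0 × (S.M × E)} (h1 : S.jumpTime n w ≤ t)
    (h2 : t < S.jumpTime (n + 1) w) :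
    S.Z t w = (S.flowM (w n).2.2 (t - S.jumpTime n w) (w n).2.1, (w n).2.2) := by
  have h : ∃ n, S.jumpTime n w ≤ t ∧ t < S.jumpTime (n + 1) w := ⟨n, h1, h2⟩
  have hmono : Monotone fun n => S.jumpTime n w := monotone_nat_of_le_succ fun k => by
    simp only [jumpTime, Finset.sum_range_succ]
    exact le_self_add
  have e : h.choose = n := by
    obtain ⟨h3, h4⟩ := h.choose_spec
    refine le_antisymm (not_lt.1 fun hlt => ?_) (not_lt.1 fun hlt => ?_)
    · exact (h2.trans_le (hmono (Nat.succ_le_of_lt hlt))).not_ge h3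
    · exact (h4.trans_le (hmono (Nat.succ_le_of_lt hlt))).not_ge h1
  rw [Z, dif_pos h, e]

variable [MeasurableSpace E]

theorem measurable_jumpTime (n : ℕ) : Measurable (S.jumpTime n) :=
  Finset.measurable_fun_sum _ fun k _ => (measurable_pi_apply (k + 1)).fst

variable [DecidableEq E] [MeasurableSingletonClass E]

theorem lintegral_stepKernel (x : S.M) (e : E) {g : ℝ≥0 × (S.M × E) → ℝ≥0∞} (hg : Measurable g) :
    ∫⁻ y, g y ∂S.stepKernel (x, e) = ∫⁻ u, ∑ e', ENNReal.ofReal (S.Q (S.flowM e u x) e e') *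
      g (u, (S.flowM e u x, e')) ∂S.waitingLaw := by
  rw [stepKernel, Kernel.lintegral_compProd _ _ _ hg, Kernel.const_apply]
  refine lintegral_congr fun u => ?_
  rw [Kernel.comap_apply]
  change ∫⁻ c, g (u, c) ∂(∑ j, ENNReal.ofReal (S.Q (S.flowM e u x) e j) •
    Measure.dirac (S.flowM e u x, j)) = _
  rw [lintegral_finsetSum_measure]
  refine Finset.sum_congr rfl fun j _ => ?_
  rw [lintegral_smul_measure, lintegral_dirac' (f := fun c => g (u, c)) _ (hg.comp measurable_prodMk_left),
    smul_eq_mul]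

theorem stepKernel_lt (z : S.M × E) (r t : ℝ≥0) :
    S.stepKernel z {y | t < r + y.1} = S.waitingLaw {u | t < r + u} := by
  have hm : MeasurableSet {u : ℝ≥0 | t < r + u} :=
    measurableSet_lt measurable_const (measurable_const.add measurable_id)
  have h : (S.stepKernel.fst z) {u | t < r + u} = S.waitingLaw {u | t < r + u} := by
    rw [stepKernel, Kernel.fst_compProd, Kernel.const_apply]
  rw [← h, Kernel.fst_apply' _ _ hm]
  rfl

/-- The Markov property of the embedded chain. -/
theorem lintegral_pathLaw_succ (x : S.M) (i : E) (n : ℕ)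
    {g : (ℝ≥0 × (S.M × E)) × (ℝ≥0 × (S.M × E)) → ℝ≥0∞} (hg : Measurable g) :
    ∫⁻ w, g ((S.jumpTime n w, (w n).2), w (n + 1)) ∂S.pathLaw x i =
      ∫⁻ w, ∫⁻ y, g ((S.jumpTime n w, (w n).2), y) ∂S.stepKernel (w n).2 ∂S.pathLaw x i := by
  -- The trajectory law disintegrates over the whole history up to `n`; `st` extracts from it the
  -- `n`-th jump time and state.
  let st : (Π _ : Finset.Iic n, ℝ≥0 × (S.M × E)) → ℝ≥0 × (S.M × E) := fun h =>
    (∑ k : Fin n, (h ⟨k + 1, Finset.mem_Iic.2 k.2⟩).1, (h ⟨n, Finset.mem_Iic.2 le_rfl⟩).2)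
  have hst : Measurable st :=
    (Finset.measurable_fun_sum _ fun k _ => (measurable_pi_apply _).fst).prodMk
      (measurable_pi_apply _).snd
  have hstw : ∀ w : ℕ → ℝ≥0 × (S.M × E),
      st (Preorder.frestrictLe (π := fun _ => ℝ≥0 × (S.M × E)) n w) =
        (S.jumpTime n w, (w n).2) := by
    intro w
    simp only [st, jumpTime, Finset.sum_range]
    rfl
  have hf : Measurable fun q : (Π _ : Finset.Iic n, ℝ≥0 × (S.M × E)) × (ℝ≥0 × (S.M × E)) =>
      g (st q.1, q.2) := hg.comp ((hst.comp measurable_fst).prodMk measurable_snd)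
  have hr : Measurable (Preorder.frestrictLe (π := fun _ : ℕ => ℝ≥0 × (S.M × E)) n) :=
    Preorder.measurable_frestrictLe n
  have hpair : Measurable fun w : ℕ → ℝ≥0 × (S.M × E) =>
      (Preorder.frestrictLe (π := fun _ : ℕ => ℝ≥0 × (S.M × E)) n w, w (n + 1)) :=
    hr.prodMk (measurable_pi_apply _)
  have h1 := Kernel.partialTraj_compProd_eq_map_traj (X := fun _ => ℝ≥0 × (S.M × E))
    (κ := S.historyKernel) (Nat.zero_le n)
    (x₀ := fun _ => ((0 : ℝ≥0), (x, i)))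
  have h2 := congrArg (fun ν => ∫⁻ q, g (st q.1, q.2) ∂ν) h1
  rw [lintegral_map hf hpair, Measure.lintegral_compProd hf,
    ← Kernel.traj_map_frestrictLe_apply, lintegral_map
      (hf.lintegral_kernel_prod_right' (κ := S.historyKernel n)) hr] at h2
  simp only [hstw] at h2
  exact h2.symm

theorem lintegral_pathLaw_zero (x : S.M) (i : E) {g : ℝ≥0 × (S.M × E) → ℝ≥0∞} (hg : Measurable g) :
    ∫⁻ w, g (S.jumpTime 0 w, (w 0).2) ∂S.pathLaw x i = g (0, (x, i)) := by
  have hr : Measurable (Preorder.frestrictLe (π := fun _ : ℕ => ℝ≥0 × (S.M × E)) 0) :=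
    Preorder.measurable_frestrictLe 0
  have h := Kernel.traj_map_frestrictLe_apply (X := fun _ => ℝ≥0 × (S.M × E)) (κ := S.historyKernel) 0 0
    (fun _ => ((0 : ℝ≥0), (x, i)))
  rw [Kernel.partialTraj_self, Kernel.id_apply] at h
  have hf : Measurable fun q : (Π _ : Finset.Iic 0, ℝ≥0 × (S.M × E)) =>
      g (0, (q ⟨0, Finset.mem_Iic.2 le_rfl⟩).2) :=
    hg.comp (measurable_const.prodMk (measurable_pi_apply _).snd)
  have h2 := congrArg (fun ν => ∫⁻ q, g (0, (q ⟨0, Finset.mem_Iic.2 le_rfl⟩).2) ∂ν) h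
  rw [lintegral_map hf hr, lintegral_dirac' _ hf] at h2
  simp only [jumpTime, Finset.sum_range_zero]
  exact h2

/-- The law of the jump time and state after `n` jumps dominates a multiple of the image of
Lebesgue measure on a box of sojourn times. -/
theorem le_lintegral_pathLaw {T p : ℝ} (x : S.M) {n : ℕ} (j : Fin (n + 1) → E)
    {s : Fin n → Set ℝ} (hs : ∀ k, MeasurableSet (s k)) (hsT : ∀ k, s k ⊆ Icc 0 T)
    (hj : S.JumpsLikely p x j s) {g : ℝ≥0 × (S.M × E) → ℝ≥0∞} (hg : Measurable g) :
    (ENNReal.ofReal (S.lam * Real.exp (-(S.lam * T))) * ENNReal.ofReal p) ^ n *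
        ∫⁻ τ in Set.pi univ s, g (∑ k, (τ k).toNNReal, (S.compositeFlowM j τ x, j (Fin.last n))) ≤
      ∫⁻ w, g (S.jumpTime n w, (w n).2) ∂S.pathLaw x (j 0) := by
  induction n generalizing g with
  | zero =>
    rw [S.lintegral_pathLaw_zero x (j 0) hg, pow_zero, one_mul]
    rw [Measure.volume_pi_eq_dirac 0]
    refine (setLIntegral_le_lintegral _ _).trans ?_
    rw [lintegral_dirac]
    rfl
  | succ n ih =>
    set a := ENNReal.ofReal (S.lam * Real.exp (-(S.lam * T)))
    set b := ENNReal.ofReal p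
    have hg2 : Measurable fun q : (ℝ≥0 × (S.M × E)) × (ℝ≥0 × (S.M × E)) =>
        g (q.1.1 + q.2.1, q.2.2) :=
      hg.comp ((measurable_fst.fst.add measurable_snd.fst).prodMk measurable_snd.snd)
    -- `h` integrates out the step `n + 1`; the induction hypothesis is applied to it.
    let h : ℝ≥0 × (S.M × E) → ℝ≥0∞ := fun q => ∫⁻ y, g (q.1 + y.1, y.2) ∂S.stepKernel q.2
    have hh : Measurable h := hg2.lintegral_kernel_prod_right'
      (κ := S.stepKernel.comap Prod.snd measurable_snd)
    have hstep : ∫⁻ w, g (S.jumpTime (n + 1) w, (w (n + 1)).2) ∂S.pathLaw x (j 0) =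
        ∫⁻ w, h (S.jumpTime n w, (w n).2) ∂S.pathLaw x (j 0) := by
      rw [← S.lintegral_pathLaw_succ x (j 0) n hg2]
      simp only [jumpTime, Finset.sum_range_succ]
    rw [hstep]
    refine le_trans ?_ (ih (Fin.init j) (s := Fin.init s) (fun k => hs k.castSucc)
      (fun k => hsT k.castSucc) hj.1 hh)
    have hgm : Measurable fun τ : Fin (n + 1) → ℝ =>
        g (∑ k, (τ k).toNNReal, (S.compositeFlowM j τ x, j (Fin.last (n + 1)))) := by
      refine hg.comp (Measurable.prodMk ?_ (Measurable.prodMk ?_ measurable_const))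
      · exact Finset.measurable_fun_sum _ fun k _ => (measurable_pi_apply k).real_toNNReal
      · exact ((S.continuous_compositeFlowM j).comp
          (continuous_const.prodMk continuous_id)).measurable
    rw [setLIntegral_pi_snoc hgm, pow_succ, mul_assoc]
    gcongr
    rw [← lintegral_const_mul' _ _ (ENNReal.mul_ne_top ENNReal.ofReal_ne_top ENNReal.ofReal_ne_top)]
    refine setLIntegral_mono' (MeasurableSet.univ_pi fun k => hs k.castSucc) fun τ hτ => ?_
    simp only [h]
    rw [S.lintegral_stepKernel _ _ (g := fun y => g (∑ k, (τ k).toNNReal + y.1, y.2)) (hg.comp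
      ((measurable_const.add measurable_fst).prodMk measurable_snd))]
    -- Of the last step only the waiting times in the last side of the box are kept, and then only
    -- the jump prescribed by `j`.
    refine le_trans ?_ (S.le_lintegral_waitingLaw (hs (Fin.last n)) (hsT (Fin.last n)) ?_)
    · rw [mul_assoc, ← lintegral_const_mul' b _ ENNReal.ofReal_ne_top]
      gcongr _ * ?_
      refine setLIntegral_mono' (hs (Fin.last n)) fun u hu => ?_
      refine le_trans ?_ (Finset.single_le_sum (fun _ _ => zero_le) (Finset.mem_univ (j (Fin.last (n + 1)))))
      have hmem : (Fin.snoc τ u : Fin (n + 1) → ℝ) ∈ Set.pi univ s := by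
        intro k _
        refine Fin.lastCases ?_ (fun k => ?_) k
        · simpa using hu
        · rw [Fin.snoc_castSucc]; exact hτ k (mem_univ k)
      have hQ := hj.2 _ hmem
      have hc : S.compositeFlowM j (Fin.snoc τ u) x = S.flowM (j (Fin.last n).castSucc) u.toNNReal
          (S.compositeFlowM (Fin.init j) τ x) := by
        simp only [compositeFlowM, Fin.snoc_last, Fin.init_snoc]
      rw [hc] at hQ ⊢
      simp only [Fin.sum_univ_castSucc, Fin.snoc_castSucc, Fin.snoc_last]
      exact mul_le_mul' (ENNReal.ofReal_le_ofReal hQ) le_rfl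
    · have hfl := S.continuous_flowM_time (Fin.init j (Fin.last n))
        (S.compositeFlowM (Fin.init j) τ x)
      refine Finset.measurable_fun_sum _ fun e' _ => Measurable.mul ?_ (hg.comp ?_)
      · exact ((S.continuous_Q _ _).comp hfl).measurable.ennreal_ofReal
      · exact (measurable_const.add measurable_id).prodMk
          (hfl.measurable.prodMk measurable_const)

/-- The law of `Z_t` dominates a multiple of the image of Lebesgue measure on a box of
sojourn times. -/
theorem le_pathLaw_Z {T p : ℝ} {T' : ℝ≥0} (x : S.M) {n : ℕ} (j : Fin (n + 1) → E)
    {s : Fin n → Set ℝ} (hs : ∀ k, MeasurableSet (s k)) (hsT : ∀ k, s k ⊆ Icc 0 T)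
    (hj : S.JumpsLikely p x j s) {t : ℝ≥0} (ht : t ≤ T') {A : Set (EuclideanSpace ℝ (Fin d))}
    (hA : MeasurableSet A) :
    ENNReal.ofReal (S.lam * Real.exp (-(S.lam * (T' + 1)))) *
      ((ENNReal.ofReal (S.lam * Real.exp (-(S.lam * T))) * ENNReal.ofReal p) ^ n *
        volume (Set.pi univ s ∩ {τ | ∑ k, τ k ≤ t} ∩ (fun τ => S.endpoint j ((x, t), τ)) ⁻¹' A)) ≤
      S.pathLaw x (j 0) {w | ((S.Z t w).1 : EuclideanSpace ℝ (Fin d)) ∈ A ∧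
        (S.Z t w).2 = j (Fin.last n)} := by
  let B : Set (ℝ≥0 × (S.M × E)) := {q | q.1 ≤ t ∧ q.2.2 = j (Fin.last n) ∧
    (S.flowM q.2.2 (t - q.1) q.2.1 : EuclideanSpace ℝ (Fin d)) ∈ A}
  have hB : MeasurableSet B := by
    refine (measurableSet_le measurable_fst measurable_const).inter
      ((measurable_snd.snd (measurableSet_singleton _)).inter ?_)
    have h1 : Measurable fun q : ℝ≥0 × (S.M × E) => S.flowM q.2.2 (t - q.1) q.2.1 :=
      (S.measurable_move.comp (measurable_snd.prodMk (measurable_const.sub measurable_fst))).fst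
    exact (measurable_subtype_coe.comp h1) hA
  -- The event that `t` falls between the jumps `n` and `n + 1`, with the required position and
  -- mode; there `Z_eq` identifies `Z_t`.
  let B' : Set ((ℝ≥0 × (S.M × E)) × (ℝ≥0 × (S.M × E))) := {q | q.1 ∈ B ∧ t < q.1.1 + q.2.1}
  have hsum : Measurable fun q : (ℝ≥0 × (S.M × E)) × (ℝ≥0 × (S.M × E)) => q.1.1 + q.2.1 :=
    measurable_fst.fst.add measurable_snd.fst
  have hlt : MeasurableSet
      {q : (ℝ≥0 × (S.M × E)) × (ℝ≥0 × (S.M × E)) | t < q.1.1 + q.2.1} :=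
    measurableSet_lt measurable_const hsum
  have hB' : MeasurableSet B' := (measurable_fst hB).inter hlt
  have hpair : Measurable fun w : ℕ → ℝ≥0 × (S.M × E) =>
      ((S.jumpTime n w, (w n).2), w (n + 1)) :=
    ((S.measurable_jumpTime n).prodMk (measurable_pi_apply n).snd).prodMk (measurable_pi_apply _)
  have hsub : (fun w : ℕ → ℝ≥0 × (S.M × E) => ((S.jumpTime n w, (w n).2), w (n + 1))) ⁻¹' B' ⊆
      {w | ((S.Z t w).1 : EuclideanSpace ℝ (Fin d)) ∈ A ∧ (S.Z t w).2 = j (Fin.last n)} := by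
    rintro w ⟨⟨h1, h2, h3⟩, h4⟩
    have hlt : t < S.jumpTime (n + 1) w := by
      rw [jumpTime, Finset.sum_range_succ]; exact h4
    have hZ := S.Z_eq h1 hlt
    refine ⟨?_, ?_⟩
    · rw [hZ]; exact h3
    · rw [hZ]; exact h2
  refine le_trans ?_ (measure_mono hsub)
  rw [← lintegral_indicator_one (hpair hB')]
  have hmk := S.lintegral_pathLaw_succ x (j 0) n (g := B'.indicator 1)
    (measurable_one.indicator hB')
  have hcomp : ∀ w : ℕ → ℝ≥0 × (S.M × E),
      ((fun w : ℕ → ℝ≥0 × (S.M × E) => ((S.jumpTime n w, (w n).2), w (n + 1))) ⁻¹' B').indicator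
        (1 : (ℕ → ℝ≥0 × (S.M × E)) → ℝ≥0∞) w = B'.indicator 1 ((S.jumpTime n w, (w n).2), w (n + 1)) := fun _ => rfl
  simp only [hcomp]
  rw [hmk]
  -- Whatever the time of the `n`-th jump, the next one comes after `t` once its waiting time
  -- exceeds `t`; this gives the extra factor.
  have hin : ∀ q : ℝ≥0 × (S.M × E), ENNReal.ofReal (S.lam * Real.exp (-(S.lam * (T' + 1)))) *
      B.indicator 1 q ≤ ∫⁻ y, B'.indicator 1 (q, y) ∂S.stepKernel q.2 := by
    intro q
    by_cases hq : q ∈ B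
    · let C : Set (ℝ≥0 × (S.M × E)) := {y | t < q.1 + y.1}
      have hsum' : Measurable fun y : ℝ≥0 × (S.M × E) => q.1 + y.1 :=
        measurable_const.add measurable_fst
      have hC : MeasurableSet C := measurableSet_lt measurable_const hsum'
      have e : ∀ y, B'.indicator (1 : (ℝ≥0 × (S.M × E)) × (ℝ≥0 × (S.M × E)) → ℝ≥0∞) (q, y) =
          C.indicator 1 y := by
        intro y
        by_cases hy : y ∈ C
        · rw [indicator_of_mem hy, indicator_of_mem (show (q, y) ∈ B' from ⟨hq, hy⟩)]; rfl
        · rw [indicator_of_notMem hy, indicator_of_notMem fun h : (q, y) ∈ B' => hy h.2]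
      simp only [e]
      rw [lintegral_indicator_one hC, stepKernel_lt, indicator_of_mem hq, Pi.one_apply, mul_one]
      refine (S.le_waitingLaw_Ioi ht).trans (measure_mono fun u hu => ?_)
      have hle : u ≤ q.1 + u := le_add_self
      exact lt_of_lt_of_le (mem_Ioi.1 hu) hle
    · rw [indicator_of_notMem hq, mul_zero]; exact zero_le
  refine le_trans ?_ (lintegral_mono fun w => hin (S.jumpTime n w, (w n).2))
  have hBm : Measurable (B.indicator (1 : ℝ≥0 × (S.M × E) → ℝ≥0∞)) := measurable_one.indicator hB
  rw [lintegral_const_mul' _ _ ENNReal.ofReal_ne_top]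
  gcongr
  refine le_trans ?_ (S.le_lintegral_pathLaw x j hs hsT hj hBm)
  gcongr
  rw [← lintegral_indicator (MeasurableSet.univ_pi hs)]
  have hC : MeasurableSet (Set.pi univ s ∩ {τ : Fin n → ℝ | ∑ k, τ k ≤ t} ∩
      (fun τ => S.endpoint j (((x : EuclideanSpace ℝ (Fin d)), (t : ℝ)), τ)) ⁻¹' A) := by
    refine ((MeasurableSet.univ_pi hs).inter (measurableSet_le (Finset.measurable_fun_sum _
      fun k _ => measurable_pi_apply k) measurable_const)).inter ?_
    exact ((S.continuous_endpoint j).comp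
      (continuous_const.prodMk continuous_id)).measurable hA
  rw [← lintegral_indicator_one hC]
  refine lintegral_mono fun τ => ?_
  by_cases hτ : τ ∈ Set.pi univ s ∩ {τ : Fin n → ℝ | ∑ k, τ k ≤ t} ∩
      (fun τ => S.endpoint j (((x : EuclideanSpace ℝ (Fin d)), (t : ℝ)), τ)) ⁻¹' A
  · obtain ⟨⟨h1, h2⟩, h3⟩ := hτ
    have h0 : ∀ k, 0 ≤ τ k := fun k => (hsT k (h1 k (mem_univ k))).1
    have hsum : ((∑ k, (τ k).toNNReal : ℝ≥0) : ℝ) = ∑ k, τ k := by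
      push_cast
      exact Finset.sum_congr rfl fun k _ => Real.coe_toNNReal _ (h0 k)
    have hle : ∑ k, (τ k).toNNReal ≤ t := by
      rw [← NNReal.coe_le_coe, hsum]; exact h2
    have hmem : (∑ k, (τ k).toNNReal, (S.compositeFlowM j τ x, j (Fin.last n))) ∈ B := by
      refine ⟨hle, rfl, ?_⟩
      have e : (S.flowM (j (Fin.last n)) (t - ∑ k, (τ k).toNNReal) (S.compositeFlowM j τ x) :
          EuclideanSpace ℝ (Fin d)) = S.endpoint j ((x, t), τ) := by
        simp only [flowM, endpoint]
        rw [S.coe_compositeFlowM j h0, NNReal.coe_sub hle, hsum]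
      change (S.flowM (j (Fin.last n)) (t - ∑ k, (τ k).toNNReal) (S.compositeFlowM j τ x) :
          EuclideanSpace ℝ (Fin d)) ∈ A
      rw [e]
      exact h3
    rw [indicator_of_mem (show τ ∈ Set.pi univ s ∩ _ ∩ _ from ⟨⟨h1, h2⟩, h3⟩),
      indicator_of_mem h1, indicator_of_mem hmem]
    simp
  · rw [indicator_of_notMem hτ]; exact zero_le

end LowerBound

/-! ### Enlarged jump sequences linking arbitrary modes -/

section Reaches

variable {d : ℕ} {E : Type*} [Fintype E] [DecidableEq E] (S : SwitchedSystem d E)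

theorem Q_self_pos (x : S.M) (i : E) : 0 < S.Q x i i := by
  rw [Q, if_pos rfl, ← Finset.sum_div, sub_pos, div_lt_one S.lam_pos]
  exact S.sum_rate_lt x i

theorem Q_pos_of_rate_pos {x : S.M} {i j : E} (h : 0 < S.rate x i j) : 0 < S.Q x i j := by
  have hij : i ≠ j := by
    rintro rfl
    exact h.ne' (S.rate_self x i)
  rw [Q, if_neg hij]
  exact div_pos h S.lam_pos

variable {V : Type*} [NormedAddCommGroup V] [NormedSpace ℝ V]

/-- The point `f w` and the mode `e` are reached at time `σ w` from `x₀` in mode `j₀`, by a fixed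
sequence of jumps of positive probability, with sojourn times `τ + D w` depending affinely on the
parameter `w`, where only sojourns of positive length vary. -/
def Reaches (x₀ : S.M) (j₀ e : E) (f : V → EuclideanSpace ℝ (Fin d)) (σ : V → ℝ) : Prop :=
  ∃ (n : ℕ) (j : Fin (n + 1) → E) (τ : Fin n → ℝ) (D : V →L[ℝ] (Fin n → ℝ)),
    j 0 = j₀ ∧ j (Fin.last n) = e ∧ (∀ k, 0 ≤ τ k) ∧ (∀ k, τ k = 0 → ∀ w, D w k = 0) ∧
      S.JumpsPossible x₀ j τ ∧ (∀ w, S.compositeFlow j (τ + D w) x₀ = f w) ∧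
      ∀ w, ∑ k, (τ + D w) k = σ w

variable {S} {x₀ : S.M} {j₀ e : E} {f : V → EuclideanSpace ℝ (Fin d)} {σ : V → ℝ}

theorem reaches_self : S.Reaches x₀ j₀ j₀ (fun _ : V => (x₀ : EuclideanSpace ℝ (Fin d)))
    fun _ => 0 :=
  ⟨0, fun _ => j₀, 0, 0, rfl, rfl, fun _ => le_rfl, fun _ _ _ => rfl, trivial, fun _ => rfl,
    fun _ => by simp⟩

theorem Reaches.mem (h : S.Reaches x₀ j₀ e f σ) : f 0 ∈ S.M := by
  obtain ⟨n, j, τ, D, -, -, hτ, -, -, hf, -⟩ := h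
  rw [← hf 0, map_zero, add_zero, ← S.coe_compositeFlowM j hτ]
  exact Subtype.coe_prop _

/-- The jump needs positive probability only on the base trajectory `w = 0`. The condition `hl`
keeps zero sojourns rigid, so that small variations leave all sojourns nonnegative. -/
theorem Reaches.step (h : S.Reaches x₀ j₀ e f σ) {a : ℝ} (ha : 0 ≤ a) {l : V →L[ℝ] ℝ}
    (hl : a = 0 → l = 0) {e' : E} (hQ : 0 < S.Q (S.flowM e a.toNNReal ⟨f 0, h.mem⟩) e e') :
    S.Reaches x₀ j₀ e' (fun w => S.Phi e (a + l w) (f w)) fun w => σ w + (a + l w) := by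
  obtain ⟨n, j, τ, D, hj0, hje, hτ, hD, hJ, hf, hσ⟩ := id h
  let D' : V →L[ℝ] (Fin (n + 1) → ℝ) := ContinuousLinearMap.pi
    (Fin.snoc (fun k => (ContinuousLinearMap.proj k).comp D) l : Fin (n + 1) → V →L[ℝ] ℝ)
  have hD' : ∀ w, D' w = Fin.snoc (D w) (l w) := by
    intro w
    funext k
    refine Fin.lastCases ?_ (fun k => ?_) k
    · simp [D']
    · simp [D']
  have hadd : ∀ w, (Fin.snoc τ a : Fin (n + 1) → ℝ) + D' w = Fin.snoc (τ + D w) (a + l w) := by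
    intro w
    rw [hD' w]
    funext k
    refine Fin.lastCases ?_ (fun k => ?_) k
    · simp
    · simp
  have hx : S.compositeFlowM j τ x₀ = ⟨f 0, h.mem⟩ := by
    refine Subtype.ext ?_
    have h0 := hf 0
    rw [map_zero, add_zero] at h0
    rw [S.coe_compositeFlowM j hτ, h0]
  refine ⟨n + 1, Fin.snoc j e', Fin.snoc τ a, D', ?_, by simp, ?_, ?_, ?_, fun w => ?_,
    fun w => ?_⟩
  · rw [← hj0, ← Fin.castSucc_zero, Fin.snoc_castSucc]
  · intro k
    refine Fin.lastCases ?_ (fun k => ?_) k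
    · simpa using ha
    · simpa using hτ k
  · intro k
    refine Fin.lastCases (fun h0 w => ?_) (fun k h0 w => ?_) k
    · rw [Fin.snoc_last] at h0
      rw [hD', Fin.snoc_last, hl h0, zero_apply]
    · rw [Fin.snoc_castSucc] at h0
      rw [hD', Fin.snoc_castSucc, hD k h0]
  · simp only [JumpsPossible, compositeFlowM, Fin.init_snoc, Fin.snoc_last, Fin.snoc_castSucc]
    rw [hx, hje]
    exact ⟨hJ, hQ⟩
  · rw [hadd]
    simp only [compositeFlow, Fin.init_snoc, Fin.snoc_last, Fin.snoc_castSucc]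
    rw [hf, hje]
  · rw [hadd, Fin.sum_univ_castSucc]
    simp only [Fin.snoc_last, Fin.snoc_castSucc]
    rw [hσ]

/-- By irreducibility every mode is reached, at no cost of time. -/
theorem Reaches.change (h : S.Reaches x₀ j₀ e f σ) (e' : E) : S.Reaches x₀ j₀ e' f σ := by
  have hirr := S.rate_irreducible ⟨f 0, h.mem⟩
  let _ : Quiver E := Matrix.toQuiver (Matrix.of (S.rate ⟨f 0, h.mem⟩))
  obtain ⟨path, -⟩ := hirr.connected e e'
  induction path with
  | nil => exact h
  | @cons b c p edge ih =>
    have hedge : 0 < S.rate ⟨f 0, h.mem⟩ b c := edge.down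
    have hfl : S.flowM b (0 : ℝ).toNNReal ⟨f 0, ih.mem⟩ = ⟨f 0, h.mem⟩ := by
      refine Subtype.ext ?_
      simp [flowM, S.Phi_zero]
    have hs := ih.step (a := 0) le_rfl (l := 0) (fun _ => rfl) (e' := c)
      (by rw [hfl]; exact S.Q_pos_of_rate_pos hedge)
    simpa [S.Phi_zero] using hs

/-- Each prescribed sojourn ends with a self-jump, always possible since `lam` strictly dominates
the total rates; zero-time jumps then lead to the next mode. Thus the prescribed switch itself may
have rate zero. -/
theorem reaches_compositeFlow {m : ℕ} (i : Fin (m + 1) → E) {u : Fin m → ℝ} (hu : ∀ k, 0 < u k)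
    (l : Fin m → V →L[ℝ] ℝ) :
    S.Reaches x₀ j₀ (i (Fin.last m)) (fun w => S.compositeFlow i (fun k => u k + l k w) x₀)
      fun w => ∑ k, (u k + l k w) := by
  induction m with
  | zero => simpa [compositeFlow] using (reaches_self (V := V)).change (i (Fin.last 0))
  | succ m ih =>
    have h := ih (Fin.init i) (u := Fin.init u) (fun k => hu k.castSucc) (Fin.init l)
    have h' := (h.step (hu (Fin.last m)).le (l := l (Fin.last m))
      (fun h0 => absurd h0 (hu (Fin.last m)).ne') (S.Q_self_pos _ _)).change (i (Fin.last (m + 1)))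
    simp only [Fin.sum_univ_castSucc]
    exact h'

/-- Following the jump sequence `i` from `x₀`, then waiting in the last mode until time `t₀`, and
jumping to the mode `e`. -/
theorem reaches_at_time {m : ℕ} (i : Fin (m + 1) → E) {u : Fin m → ℝ} (hu : ∀ k, 0 < u k)
    {t₀ : ℝ} (ht₀ : ∑ k, u k < t₀) (e : E) :
    S.Reaches (V := Fin m → ℝ) x₀ j₀ e (fun w => S.Phi (i (Fin.last m)) (t₀ - ∑ k, (u + w) k)
      (S.compositeFlow i (u + w) x₀)) fun _ => t₀ := by
  have h := reaches_compositeFlow (S := S) (x₀ := x₀) (j₀ := j₀) i hu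
    (fun k => ContinuousLinearMap.proj (R := ℝ) (φ := fun _ : Fin m => ℝ) k)
  have ha : 0 < t₀ - ∑ k, u k := sub_pos.2 ht₀
  have h' := (h.step ha.le
    (l := -∑ k, ContinuousLinearMap.proj (R := ℝ) (φ := fun _ : Fin m => ℝ) k)
    (fun h0 => absurd h0 ha.ne') (S.Q_self_pos _ _)).change e
  convert h' using 2 with w w
  · congr 1
    simp [Finset.sum_add_distrib]
    ring
  · simp [Finset.sum_add_distrib]
    ring

end Reaches

end SwitchedSystem

/-! ### Assembly of the lower bound, uniformly in the modes -/

theorem exists_pos_of_mul_le {a b C : ℝ≥0∞} (ha : a ≠ 0) (ha' : a ≠ ⊤) (hb : b ≠ 0) (hb' : b ≠ ⊤)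
    (hC : C ≠ 0) (hC' : C ≠ ⊤) :
    ∃ c : ℝ, 0 < c ∧ ∀ X Y : ℝ≥0∞, a * X ≤ b * Y → ENNReal.ofReal c * X ≤ C * Y := by
  have h0 : C * a / b ≠ 0 := (ENNReal.div_pos (mul_ne_zero hC ha) hb').ne'
  have ht : C * a / b ≠ ⊤ := ENNReal.div_ne_top (ENNReal.mul_ne_top hC' ha') hb
  refine ⟨(C * a / b).toReal, ENNReal.toReal_pos h0 ht, fun X Y h => ?_⟩
  rw [ENNReal.ofReal_toReal ht]
  calc C * a / b * X = C * (a * X) / b := by simp only [div_eq_mul_inv]; ring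
    _ ≤ C * (b * Y) / b := by gcongr
    _ = C * Y * (b * b⁻¹) := by simp only [div_eq_mul_inv]; ring
    _ = C * Y := by rw [ENNReal.mul_inv_cancel hb hb', mul_one]

/-- Near a nonnegative nonzero vector there are positive vectors of smaller sum. -/
theorem exists_pos_sum_lt {n : ℕ} {τ : Fin n → ℝ} (hτ : ∀ k, 0 ≤ τ k) (hs : 0 < ∑ k, τ k)
    {η : ℝ} (hη : 0 < η) :
    ∃ v ∈ Metric.ball τ η, (∀ k, 0 < v k) ∧ ∑ k, v k < ∑ k, τ k := by
  -- The factor `1 - ε` lowers the sum by `ε * ∑ k, τ k`, to first order; adding `ε ^ 2` makes the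
  -- entries positive at the second-order cost `n * ε ^ 2`.
  have hc : Continuous fun ε : ℝ => (fun k => (1 - ε) * τ k + ε ^ 2 : Fin n → ℝ) := by fun_prop
  have h1 : ∀ᶠ ε in 𝓝[>] (0 : ℝ), (fun k => (1 - ε) * τ k + ε ^ 2) ∈ Metric.ball τ η := by
    refine nhdsWithin_le_nhds (hc.continuousAt (Metric.isOpen_ball.mem_nhds ?_))
    simpa using hη
  have h2 : ∀ᶠ ε in 𝓝[>] (0 : ℝ), ε * n < ∑ k, τ k := by
    refine nhdsWithin_le_nhds ((Continuous.tendsto (by fun_prop) 0).eventually_lt_const ?_)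
    simpa using hs
  have h3 : ∀ᶠ ε in 𝓝[>] (0 : ℝ), ε < 1 := nhdsWithin_le_nhds (Iio_mem_nhds one_pos)
  obtain ⟨ε, ⟨⟨h1, h2⟩, h3⟩, h4⟩ := (((h1.and h2).and h3).and self_mem_nhdsWithin).exists
  have h4 : 0 < ε := h4
  refine ⟨_, h1, fun k => ?_, ?_⟩
  · have := mul_nonneg (sub_nonneg.2 h3.le) (hτ k)
    positivity
  · rw [Finset.sum_add_distrib, ← Finset.mul_sum]
    simp only [Finset.sum_const, Finset.card_univ, Fintype.card_fin, nsmul_eq_mul]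
    nlinarith

namespace SwitchedSystem

section AbsoluteContinuity

variable {d : ℕ} {E : Type*} [Fintype E] (S : SwitchedSystem d E)

/-- The endpoint at time `t` of the trajectory from `x`, as a function of the sojourn times, is
strictly differentiable. -/
theorem exists_hasStrictFDerivAt_endpoint_right {m : ℕ} (i : Fin (m + 1) → E)
    (x : EuclideanSpace ℝ (Fin d)) (t : ℝ) (v : Fin m → ℝ) :
    ∃ L : (Fin m → ℝ) →L[ℝ] EuclideanSpace ℝ (Fin d),
      HasStrictFDerivAt (fun v => S.endpoint i ((x, t), v)) L v := by
  obtain ⟨L, hL⟩ := S.exists_hasStrictFDerivAt_endpoint i ((x, t), v)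
  exact ⟨_, hL.comp v ((hasStrictFDerivAt_const (x, t) v).prodMk (hasStrictFDerivAt_id v))⟩

/-- The endpoint at time `s` is the image of the one at time `t` under the flow for time `s - t`.
The derivative `L'` of that flow is surjective because the composite is, hence injective by equality
of dimensions, and can be cancelled. -/
theorem surjective_fderiv_endpoint {m : ℕ} (i : Fin (m + 1) → E) (x : EuclideanSpace ℝ (Fin d))
    {s : ℝ} (t : ℝ) {u : Fin m → ℝ}
    (h : Function.Surjective (fderiv ℝ (fun v => S.endpoint i ((x, s), v)) u)) :
    Function.Surjective (fderiv ℝ (fun v => S.endpoint i ((x, t), v)) u) := by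
  obtain ⟨L, hL⟩ := S.exists_hasStrictFDerivAt_endpoint_right i x t u
  obtain ⟨L', hL'⟩ := S.exists_hasStrictFDerivAt_Phi_comp (W := EuclideanSpace ℝ (Fin d))
    (i (Fin.last m)) (w := S.endpoint i ((x, t), u))
    ⟨_, hasStrictFDerivAt_const (s - t) _⟩ ⟨_, hasStrictFDerivAt_id _⟩
  have hcomp := hL'.comp u (f := fun v => S.endpoint i ((x, t), v)) hL
  have e : (fun v => S.endpoint i ((x, s), v)) =
      fun v => S.Phi (i (Fin.last m)) (s - t) (id (S.endpoint i ((x, t), v))) := by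
    funext v
    simp only [endpoint, id]
    rw [← S.Phi_add]
    ring_nf
  rw [e, hcomp.hasFDerivAt.fderiv] at h
  rw [hL.hasFDerivAt.fderiv]
  have hsurj : Function.Surjective L' := fun a => by
    obtain ⟨v, hv⟩ := h a
    exact ⟨L v, hv⟩
  have hinj : Function.Injective L' := LinearMap.injective_iff_surjective.2 hsurj
  intro a
  obtain ⟨v, hv⟩ := h (L' a)
  exact ⟨v, hinj hv⟩

variable [DecidableEq E] [MeasurableSpace E] [MeasurableSingletonClass E]

/-- The lower bound between two fixed modes, when all sojourn times are positive. -/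
theorem exists_le_pathLaw_of_pos (x₀ : S.M) {m : ℕ} (i : Fin (m + 1) → E) {u : Fin m → ℝ}
    (hu : ∀ k, 0 < u k) {t₀ : ℝ≥0} (ht₀ : ∑ k, u k < t₀)
    (hsub : Function.Surjective (fderiv ℝ (fun v => S.endpoint i ((x₀, t₀), v)) u)) (j₀ j₁ : E) :
    ∃ U ∈ 𝓝 (x₀ : EuclideanSpace ℝ (Fin d)), ∃ r > 0, ∃ c > 0, ∃ ε > 0, ∀ x : S.M,
      (x : EuclideanSpace ℝ (Fin d)) ∈ U → ∀ t ∈ Icc t₀ (t₀ + ε),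
        ∀ A : Set (EuclideanSpace ℝ (Fin d)), MeasurableSet A →
          ENNReal.ofReal c * volume (A ∩ Metric.ball (S.endpoint i ((x₀, t₀), u)) r) ≤
            S.pathLaw x j₀
              {w | ((S.Z t w).1 : EuclideanSpace ℝ (Fin d)) ∈ A ∧ (S.Z t w).2 = j₁} := by
  obtain ⟨n, j, τ, D, rfl, rfl, hτ, hD, hJ, hf, hσ⟩ :=
    reaches_at_time (S := S) (x₀ := x₀) (j₀ := j₀) i hu ht₀ j₁
  have hτsum : ∑ k, τ k = t₀ := by simpa using hσ 0
  have hDsum : ∀ w, ∑ k, D w k = 0 := by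
    intro w
    have := hσ w
    simp only [Pi.add_apply, Finset.sum_add_distrib, hτsum] at this
    linarith
  have ht₀' : (0 : ℝ) < t₀ := (Finset.sum_nonneg fun k _ => (hu k).le).trans_lt ht₀
  -- The sojourns `τ + D w` already fill the time `t₀`, so nothing remains to be spent in the final
  -- mode. Differentiating this identity at `w = 0` gives `hLD`.
  have hend : ∀ w, S.endpoint j ((x₀, t₀), τ + D w) = S.endpoint i ((x₀, t₀), u + w) := by
    intro w
    rw [endpoint, hf, hσ, sub_self, S.Phi_zero]
    rfl
  obtain ⟨L, hL⟩ := S.exists_hasStrictFDerivAt_endpoint j ((x₀, t₀), τ)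
  have hLD : ∀ w, L (0, D w) = fderiv ℝ (fun v => S.endpoint i ((x₀, t₀), v)) u w := by
    obtain ⟨L', hL'⟩ := S.exists_hasStrictFDerivAt_endpoint_right i x₀ t₀ u
    have h1 : HasFDerivAt (fun w : Fin m → ℝ => S.endpoint i ((x₀, t₀), u + w)) L' 0 := by
      have h : HasFDerivAt (fun v => S.endpoint i ((x₀, t₀), v)) L' (u + 0) := by
        rw [add_zero]; exact hL'.hasFDerivAt
      have := h.comp 0 ((hasFDerivAt_id (𝕜 := ℝ) (0 : Fin m → ℝ)).const_add u)
      exact this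
    have h2 : HasFDerivAt (fun w : Fin m → ℝ => S.endpoint j ((x₀, t₀), τ + D w))
        (L.comp ((0 : (Fin m → ℝ) →L[ℝ] EuclideanSpace ℝ (Fin d) × ℝ).prod D)) 0 := by
      have h : HasFDerivAt (S.endpoint j) L (((x₀ : EuclideanSpace ℝ (Fin d)), (t₀ : ℝ)),
          τ + D 0) := by
        rw [map_zero, add_zero]; exact hL.hasFDerivAt
      exact h.comp 0 (f := fun w : Fin m → ℝ =>
        (((x₀ : EuclideanSpace ℝ (Fin d)), (t₀ : ℝ)), τ + D w))
        ((hasFDerivAt_const _ (0 : Fin m → ℝ)).prodMk ((D.hasFDerivAt (x := 0)).const_add τ))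
    simp only [hend] at h2
    intro w
    rw [hL'.hasFDerivAt.fderiv, ← h2.unique h1]
    rfl
  obtain ⟨R₀, hR₀⟩ := LinearMap.exists_rightInverse_of_surjective
    (fderiv ℝ (fun v => S.endpoint i ((x₀, t₀), v)) u).toLinearMap
    (LinearMap.range_eq_top.2 hsub)
  -- Passing through `D` makes `R a` vanish where `τ` does and have coordinate sum zero.
  let R : EuclideanSpace ℝ (Fin d) →L[ℝ] (Fin n → ℝ) :=
    D.comp (LinearMap.toContinuousLinearMap R₀)
  have hR : ∀ a, L (0, R a) = a := fun a => (hLD _).trans (LinearMap.congr_fun hR₀ a)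
  obtain ⟨p, hp, r₁, hr₁, hlikely⟩ := hJ.exists_jumpsLikely
  -- A base point and its translate each contribute a displacement of at most `r`: the sum must stay
  -- in the box and leave the positive sojourns nonnegative.
  have hr : ∃ r > 0, 2 * r ≤ r₁ ∧ ∀ k, 0 < τ k → 2 * r ≤ τ k := by
    have h1 : ∀ {b : ℝ}, 0 < b → ∀ᶠ r in 𝓝[>] (0 : ℝ), 2 * r ≤ b := fun {b} hb => by
      filter_upwards [nhdsWithin_le_nhds (Iio_mem_nhds (half_pos hb))] with r hr
      linarith [mem_Iio.1 hr]
    have h2 : ∀ᶠ r in 𝓝[>] (0 : ℝ), ∀ k, 0 < τ k → 2 * r ≤ τ k :=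
      eventually_all.2 fun k => by
        by_cases hk : 0 < τ k
        · filter_upwards [h1 hk] with r hr _ using hr
        · exact .of_forall fun _ h => absurd h hk
    obtain ⟨r, ⟨h3, h4⟩, h5⟩ := (((h1 hr₁).and h2).and self_mem_nhdsWithin).exists
    exact ⟨r, h5, h3, h4⟩
  obtain ⟨r, hr0, hrr₁, hrτ⟩ := hr
  obtain ⟨δ, hδ, hball⟩ := exists_measure_inter_ball_le_preimage
    (volume : Measure (EuclideanSpace ℝ (Fin d)))
  obtain ⟨ρ, hρ, η, hη, hηr, hRr, happ⟩ := hL.exists_approximatesLinearOn R hR hδ hr0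
  -- Base points are taken inside the admissible region, since `τ` may have zero entries and has sum
  -- `t₀`. Translating by `R a` keeps the sum below `t₀ ≤ t`.
  let K : Set (Fin n → ℝ) := Metric.ball τ η ∩ ({v | ∀ k, 0 < v k} ∩ {v | ∑ k, v k < t₀})
  have hKo : IsOpen K := by
    refine Metric.isOpen_ball.inter (IsOpen.inter ?_ ?_)
    · simp only [ofPred_forall]
      exact isOpen_iInter_of_finite fun k => isOpen_lt continuous_const (continuous_apply k)
    · exact isOpen_lt (continuous_finsetSum _ fun k _ => continuous_apply k) continuous_const
  have hKne : K.Nonempty := by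
    obtain ⟨v, hv1, hv2, hv3⟩ := exists_pos_sum_lt hτ (by rw [hτsum]; exact ht₀') hη
    exact ⟨v, hv1, hv2, by rw [← hτsum]; exact hv3⟩
  have hK0 : volume K ≠ 0 := (hKo.measure_pos volume hKne).ne'
  have hKt : volume K ≠ ⊤ :=
    ((measure_mono inter_subset_left).trans_lt Metric.isBounded_ball.measure_lt_top).ne
  let s : Fin n → Set ℝ := fun k => Metric.ball (τ k) r₁ ∩ Ici 0
  have hs : ∀ k, MeasurableSet (s k) := fun k => measurableSet_ball.inter measurableSet_Ici
  have hsT : ∀ k, s k ⊆ Icc 0 (t₀ + r₁) := by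
    rintro k v ⟨hv1, hv2⟩
    refine ⟨hv2, ?_⟩
    have h1 : τ k ≤ t₀ := by
      rw [← hτsum]; exact Finset.single_le_sum (fun k _ => hτ k) (Finset.mem_univ k)
    rw [Metric.mem_ball, Real.dist_eq] at hv1
    linarith [le_abs_self (v - τ k)]
  have hlam := S.lam_pos
  obtain ⟨c, hc, hcle⟩ := exists_pos_of_mul_le (a := volume K)
    (b := 2 * volume (Metric.closedBall (0 : EuclideanSpace ℝ (Fin d)) ρ))
    (C := ENNReal.ofReal (S.lam * Real.exp (-(S.lam * ((t₀ + 1 : ℝ≥0) + 1)))) *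
      (ENNReal.ofReal (S.lam * Real.exp (-(S.lam * (t₀ + r₁)))) * ENNReal.ofReal p) ^ n) hK0 hKt
    (mul_ne_zero two_ne_zero (Metric.measure_closedBall_pos _ _ hρ).ne')
    (ENNReal.mul_ne_top (by simp) Metric.isBounded_closedBall.measure_lt_top.ne)
    (mul_ne_zero (by positivity) (pow_ne_zero _ (mul_ne_zero (by positivity) (by positivity))))
    (ENNReal.mul_ne_top ENNReal.ofReal_ne_top (ENNReal.pow_ne_top
      (ENNReal.mul_ne_top ENNReal.ofReal_ne_top ENNReal.ofReal_ne_top)))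
  obtain ⟨U₁, hU₁, T₁, hT₁, hUT⟩ := mem_nhds_prod_iff.1 happ
  rw [nhds_subtype_eq_comap] at hlikely
  obtain ⟨U₂, hU₂, hU₂'⟩ := hlikely
  obtain ⟨ε, hε, hεT⟩ := Metric.mem_nhds_iff.1 hT₁
  have hε' : 0 < min (1 : ℝ≥0) (ε / 2).toNNReal :=
    lt_min one_pos (Real.toNNReal_pos.2 (half_pos hε))
  refine ⟨U₁ ∩ U₂, inter_mem hU₁ hU₂, ρ / 4, by positivity, c, hc, _, hε',
    fun x hx t ht A hA => ?_⟩
  have htT : (t : ℝ) ∈ T₁ := by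
    refine hεT ?_
    rw [Metric.mem_ball, Real.dist_eq, abs_of_nonneg (sub_nonneg.2 (NNReal.coe_le_coe.2 ht.1))]
    have h1 : t ≤ t₀ + (ε / 2).toNNReal := ht.2.trans (by gcongr; exact min_le_right _ _)
    have h2 : (t : ℝ) ≤ t₀ + ε / 2 := by
      rw [← Real.coe_toNNReal (ε / 2) (half_pos hε).le]; exact_mod_cast h1
    linarith
  have ht1 : t ≤ t₀ + 1 := ht.2.trans (by gcongr; exact min_le_left _ _)
  have happ' := hUT (show ((x : EuclideanSpace ℝ (Fin d)), (t : ℝ)) ∈ U₁ ×ˢ T₁ from ⟨hx.1, htT⟩)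
  have hzz : S.endpoint j ((x₀, t₀), τ) = S.endpoint i ((x₀, t₀), u) := by
    simpa using hend 0
  have hmeas : Measurable fun v => S.endpoint j ((x, t), v) :=
    ((S.continuous_endpoint j).comp (continuous_const.prodMk continuous_id)).measurable
  have hlow := measure_mul_measure_inter_ball_le volume volume hball hmeas R hKo.measurableSet hρ.le
    (Ω := Set.pi univ s ∩ {τ | ∑ k, τ k ≤ t}) (z := S.endpoint i ((x₀, t₀), u))
    (fun v hv a ha => ?_) (fun v hv => (happ' v hv.1).1)
    (fun v hv => by rw [← hzz]; exact (happ' v hv.1).2) hA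
  · refine (hcle _ _ hlow).trans ?_
    rw [mul_assoc]
    exact S.le_pathLaw_Z x j hs hsT (JumpsLikely.mono le_rfl (fun k => inter_subset_left)
      (hU₂' hx.2)) ht1 hA
  · have hcoord : ∀ k, |(R a) k| ≤ r := fun k => by
      have := (norm_le_pi_norm (R a) k).trans (hRr a ha)
      rwa [Real.norm_eq_abs] at this
    have hvk : ∀ k, |v k - τ k| < r := fun k => by
      have := (dist_le_pi_dist v τ k).trans_lt (Metric.mem_ball.1 hv.1)
      rw [Real.dist_eq] at this
      linarith
    refine ⟨fun k _ => ⟨?_, ?_⟩, ?_⟩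
    · rw [Metric.mem_ball, Real.dist_eq, Pi.add_apply, add_sub_right_comm]
      refine (abs_add_le _ _).trans_lt ?_
      linarith [hcoord k, hvk k]
    · rw [mem_Ici, Pi.add_apply]
      rcases (hτ k).eq_or_lt with h0 | h0
      · have : (R a) k = 0 := hD k h0.symm _
        rw [this, add_zero]
        exact (hv.2.1 k).le
      · linarith [hrτ k h0, (abs_le.1 (hcoord k)).1, (abs_lt.1 (hvk k)).1]
    · change ∑ k, (v + R a) k ≤ t
      simp only [Pi.add_apply, Finset.sum_add_distrib]
      have h1 : ∑ k, (R a) k = 0 := hDsum _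
      have h2 : (t₀ : ℝ) ≤ t := NNReal.coe_le_coe.2 ht.1
      have h3 : ∑ k, v k < t₀ := hv.2.2
      linarith

/-- The lower bound, uniformly in the modes, when all sojourn times are positive. -/
theorem exists_le_pathLaw_forall_mode (x₀ : S.M) {m : ℕ} (i : Fin (m + 1) → E) {u : Fin m → ℝ}
    (hu : ∀ k, 0 < u k) {t₀ : ℝ≥0} (ht₀ : ∑ k, u k < t₀)
    (hsub : Function.Surjective (fderiv ℝ (fun v => S.endpoint i ((x₀, t₀), v)) u))
    {W : Set (EuclideanSpace ℝ (Fin d))} (hW : W ∈ 𝓝 (S.endpoint i ((x₀, t₀), u))) :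
    ∃ U₀ ∈ 𝓝 (x₀ : EuclideanSpace ℝ (Fin d)), ∃ V : Set (EuclideanSpace ℝ (Fin d)),
      IsOpen V ∧ V ⊆ W ∧ S.endpoint i ((x₀, t₀), u) ∈ V ∧
      ∃ c : ℝ, 0 < c ∧ ∃ ε : ℝ≥0, 0 < ε ∧
        ∀ x : S.M, (x : EuclideanSpace ℝ (Fin d)) ∈ U₀ → ∀ j₀ j : E,
          ∀ t ∈ Icc t₀ (t₀ + ε), ∀ A : Set (EuclideanSpace ℝ (Fin d)), MeasurableSet A →
            ENNReal.ofReal c * volume (A ∩ V) ≤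
              S.pathLaw x j₀
                {w | ((S.Z t w).1 : EuclideanSpace ℝ (Fin d)) ∈ A ∧ (S.Z t w).2 = j} := by
  -- There are finitely many pairs of modes, so neighbourhoods can be intersected and constants
  -- lowered to common ones.
  have h := fun q : E × E => S.exists_le_pathLaw_of_pos x₀ i hu ht₀ hsub q.1 q.2
  choose U hU r hr c hc ε hε key using h
  have hcev : ∀ᶠ b in 𝓝[>] (0 : ℝ), ∀ q : E × E, b ≤ c q :=
    eventually_all.2 fun q => nhdsWithin_le_nhds (Iic_mem_nhds (hc q))
  have hεev : ∀ᶠ b in 𝓝[>] (0 : ℝ≥0), ∀ q : E × E, b ≤ ε q :=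
    eventually_all.2 fun q => nhdsWithin_le_nhds (Iic_mem_nhds (hε q))
  obtain ⟨c', hc', hc0⟩ := (hcev.and self_mem_nhdsWithin).exists
  obtain ⟨ε', hε', hε0⟩ := (hεev.and self_mem_nhdsWithin).exists
  refine ⟨⋂ q, U q, iInter_mem.2 hU,
    interior W ∩ ⋂ q, Metric.ball (S.endpoint i ((x₀, t₀), u)) (r q),
    isOpen_interior.inter (isOpen_iInter_of_finite fun _ => Metric.isOpen_ball),
    inter_subset_left.trans interior_subset,
    ⟨mem_interior_iff_mem_nhds.2 hW, mem_iInter.2 fun q => Metric.mem_ball_self (hr q)⟩,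
    c', hc0, ε', hε0, fun x hx j₀ j t ht A hA => ?_⟩
  refine le_trans ?_ (key (j₀, j) x (mem_iInter.1 hx _) t
    ⟨ht.1, ht.2.trans (add_le_add_right (hε' (j₀, j)) _)⟩ A hA)
  gcongr
  · exact hc' (j₀, j)
  · exact inter_subset_right.trans (iInter_subset _ _)

end AbsoluteContinuity

end SwitchedSystem

theorem mainTheorem5 {d : ℕ} (hd : 1 ≤ d) {E : Type*} [Fintype E] [DecidableEq E]
    [MeasurableSpace E] [MeasurableSingletonClass E] (S : SwitchedSystem d E)
    (x₀ y : EuclideanSpace ℝ (Fin d)) (hx₀ : x₀ ∈ S.M)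
    {m : ℕ} (i : Fin (m + 1) → E) (u : Fin m → ℝ) (hu : ∀ k, 0 ≤ u k)
    (hy : S.compositeFlow i u x₀ = y)
    (hsub : ∃ s : ℝ, ∑ k, u k < s ∧
      SubmersionAt
        (fun v => S.Phi (i (Fin.last m)) (s - ∑ k, v k) (S.compositeFlow i v x₀)) u)
    (t₀ : ℝ≥0) (ht₀ : ∑ k, u k < t₀) :
    ∀ W ∈ 𝓝 (S.Phi (i (Fin.last m)) (t₀ - ∑ k, u k) y),
      ∃ U₀ ∈ 𝓝 x₀, ∃ V : Set (EuclideanSpace ℝ (Fin d)),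
        IsOpen V ∧ V.Nonempty ∧ V ⊆ W ∧
        ((∀ k, 0 < u k) → S.Phi (i (Fin.last m)) (t₀ - ∑ k, u k) y ∈ V) ∧
        ∃ c : ℝ, 0 < c ∧ ∃ ε : ℝ≥0, 0 < ε ∧
          ∀ x : S.M, (x : EuclideanSpace ℝ (Fin d)) ∈ U₀ → ∀ j₀ j : E,
            ∀ t ∈ Icc t₀ (t₀ + ε), ∀ A : Set (EuclideanSpace ℝ (Fin d)), MeasurableSet A →
              ENNReal.ofReal c * volume (A ∩ V) ≤
                S.pathLaw x j₀
                  {w | ((S.Z t w).1 : EuclideanSpace ℝ (Fin d)) ∈ A ∧ (S.Z t w).2 = j} := by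
  subst hy
  intro W hW
  obtain ⟨s, -, -, hs⟩ := hsub
  have hsurj := S.surjective_fderiv_endpoint i x₀ (s := s) t₀ hs
  by_cases hpos : ∀ k, 0 < u k
  · obtain ⟨U₀, hU₀, V, hVo, hVW, hzV, h⟩ :=
      S.exists_le_pathLaw_forall_mode ⟨x₀, hx₀⟩ i hpos ht₀ hsurj hW
    exact ⟨U₀, hU₀, V, hVo, ⟨_, hzV⟩, hVW, fun _ => hzV, h⟩
  -- Adding a small `b > 0` to every sojourn preserves surjectivity, the bound on the sum, and the
  -- fact that `W` is a neighbourhood of the endpoint.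
  · have hdiff := S.exists_hasStrictFDerivAt_endpoint_right i x₀ t₀
    have hc : ContinuousAt (fderiv ℝ fun v => S.endpoint i ((x₀, t₀), v)) u :=
      (hdiff u).choose_spec.continuousAt_fderiv
        (.of_forall fun v => (hdiff v).choose_spec.differentiableAt)
    have h1 : ∀ᶠ v in 𝓝 u, Function.Surjective
        (fderiv ℝ (fun v => S.endpoint i ((x₀, t₀), v)) v) :=
      hc.eventually (ContinuousLinearMap.eventually_surjective hsurj)
    have hsum : Continuous fun v : Fin m → ℝ => ∑ k, v k :=
      continuous_finsetSum _ fun k _ => continuous_apply k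
    have h2 : ∀ᶠ v in 𝓝 u, ∑ k, v k < (t₀ : ℝ) := (hsum.tendsto u).eventually_lt_const ht₀
    have h3 : ∀ᶠ v in 𝓝 u, W ∈ 𝓝 (S.endpoint i ((x₀, t₀), v)) :=
      (hdiff u).choose_spec.continuousAt.eventually (eventually_mem_nhds_iff.2 hW)
    have hpath : Tendsto (fun b : ℝ => u + fun _ => b) (𝓝[>] 0) (𝓝 u) := by
      have : Continuous fun b : ℝ => u + fun _ => b := by fun_prop
      have h0 := this.tendsto 0
      rw [show (u + fun _ => (0 : ℝ)) = u from add_zero u] at h0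
      exact tendsto_nhdsWithin_of_tendsto_nhds h0
    obtain ⟨b, hb, hb0⟩ := ((hpath.eventually (h1.and (h2.and h3))).and self_mem_nhdsWithin).exists
    obtain ⟨U₀, hU₀, V, hVo, hVW, hzV, h⟩ := S.exists_le_pathLaw_forall_mode ⟨x₀, hx₀⟩ i
      (u := u + fun _ => b) (fun k => add_pos_of_nonneg_of_pos (hu k) hb0) hb.2.1 hb.1 hb.2.2
    exact ⟨U₀, hU₀, V, hVo, ⟨_, hzV⟩, hVW, fun h => absurd h hpos, h⟩
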